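/- Let $\mathfrak m=\mathrm{diag}(-1,1,1,1)$ be the Minkowski metric on $\mathbb R^{3+1}$ (coordinates $x^0,\dots,x^3$), let $\Box=\mathfrak m^{\mu\nu}\partial_\mu\partial_\nu$, and consider the system $$\Box\phi^I=F^I(\phi,\partial\phi),\qquad I=1,\dots,N,\qquad \phi=(\phi^1,\dots,\phi^N):\mathbb R^{3+1}\to\mathbb R^N,$$ where each $F^I$ is a homogeneous quadratic polynomial (a quadratic form) in $(\phi,\partial\phi)$. Let $Q_{F^I}(p)=\tfrac12 D^2F^I(0)[(0,p),(0,p)]$, $p=(p_\mu^J)\in T^*\mathbb R^{3+1}\otimes\mathbb R^N$, be the part of the Taylor expansion of $F^I$ at $0$ which is quadratic in $\partial\phi=p$. Assume the null condition: $F^I(0)=0$, $\partial F^I(0)=0$, and there are real constants $A^{\mu\nu}_{IJK}$ with $$Q_{F^I}(p)=\sum_{J,K=1}^N\sum_{\mu,\nu=0}^3A^{\mu\nu}_{IJK}\,p^J_\mu\,p^K_\nu ,\qquad \sum_{\mu,\nu=0}^3A^{\mu\nu}_{IJK}\,\xi_\mu\xi_\nu=0\ \text{ for all } I,J,K \text{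 and all } \xi\in\mathbb R^4 \text{ with } \mathfrak m^{\mu\nu}\xi_\mu\xi_\nu=0 .$$ For each $I$ let $\mathcal T_I$ be the operator $(\mathcal T_Is)_K=\sum_{J,\mu,\nu}A^{\mu\nu}_{IJK}\,\partial_\nu s^J_\mu$, and let $$\Lambda_{\mathcal T_I}=\Big\{\lambda=(\lambda^J_\mu):\ \exists\,\xi\in\mathbb R^4\setminus\{0\}\ \ \forall K:\ \sum_{J=1}^N\sum_{\mu,\nu=0}^3A^{\mu\nu}_{IJK}\,\lambda^J_\mu\,\xi_\nu=0\Big\}$$ be its operator cone, that is, the set of $\lambda$ annihilated by the principal symbol of $\mathcal T_I$ at some non-zero co-vector. Assume further that $Q_{F^I}(\lambda)=0$ for all $\lambda\in\Lambda_{\mathcal T_I}$ and all $I$. Let $\{\phi_\varepsilon\}\subset H^1_{\rm loc}(\mathbb R^{3+1};\mathbb R^N)$ be a family such that (i) $\phi_\varepsilon\rightharpoonup\phi$ weakly in $H^1_{\rm loc}$; (ii) $\big\{\sum_{J}\sum_{\mu,\nu}A^{\mu\nu}_{IJK}\,\partial_\mu\partial_\nu\phi^J_\varepsilon\big\}_\varepsilon$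 is pre-compact in $H^{-1}_{\rm loc}(\mathbb R^{3+1})$ for all $I,K\in\{1,\dots,N\}$. Then, for every $I$, $Q_{F^I}(\partial\phi_\varepsilon)\rightharpoonup Q_{F^I}(\partial\phi)$ in the sense of distributions. Consequently, if all $\phi_\varepsilon$ are moreover weak solutions of the system (in $H^1_{\rm loc}$, the equations holding in the sense of distributions), then the weak limit $\phi$ is also a weak solution. Here the family may be indexed by any set, with the limit taken along any proper countably generated filter on it (for instance a sequence, or $\varepsilon\to0^+$). -/

import Mathlib

open MeasureTheory Filter Topology TopologicalSpace
open scoped ContDiff Distributions LineDeriv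

noncomputable section

namespace NullWave

/-- The space-time `ℝ^{3+1}`; the coordinate `0` is time, the coordinates `1, 2, 3` are space. -/
abbrev Spacetime : Type := EuclideanSpace ℝ (Fin 4)

/-- Test functions `C_c^∞(ℝ^{3+1})`. -/
abbrev Test : Type := 𝓓((⊤ : Opens Spacetime), ℝ)

/-- Distributions on `ℝ^{3+1}`. -/
abbrev Distrib4 : Type := 𝓓'((⊤ : Opens Spacetime), ℝ)

/-- The coordinate vector `e_μ`. -/
def e (μ : Fin 4) : Spacetime := EuclideanSpace.single μ 1

/-- The distribution `ψ ↦ ∫ ψ f` of a locally integrable function `f`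
(it is `0` if `f` is not locally integrable). -/
def toDistrib (f : Spacetime → ℝ) : Distrib4 :=
  ContinuousLinearMap.toUniformConvergenceCLM (RingHom.id ℝ) ℝ _
    (TestFunction.integralAgainstBilinCLM (ContinuousLinearMap.mul ℝ ℝ) volume f)

/-! ### Sobolev spaces -/

/-- `f ∈ L²_loc(ℝ^{3+1})`. -/
def MemL2loc (f : Spacetime → ℝ) : Prop :=
  ∀ K : Set Spacetime, IsCompact K → MemLp f 2 (volume.restrict K)

/-- `g ∈ L²_loc` is the weak (distributional) derivative `∂_μ f`. -/
def IsWeakDeriv (μ : Fin 4) (f g : Spacetime → ℝ) : Prop :=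
  MemL2loc g ∧ ∂_{e μ} (toDistrib f) = toDistrib g

/-- `f ∈ H¹_loc(ℝ^{3+1})`. -/
def MemH1loc (f : Spacetime → ℝ) : Prop :=
  MemL2loc f ∧ ∀ μ : Fin 4, ∃ g, IsWeakDeriv μ f g

open Classical in
/-- The weak derivative `∂_μ f` as an `L²_loc` function (unique up to null sets);
it is `0` if there is none. -/
def weakDeriv (μ : Fin 4) (f : Spacetime → ℝ) : Spacetime → ℝ :=
  if h : ∃ g, IsWeakDeriv μ f g then h.choose else 0

/-- Weak convergence `u_i ⇀ u` in `L²_loc`: convergence of the pairings with all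
compactly supported `L²` functions. -/
def WeakTendstoL2loc {ι : Type*} (u : ι → Spacetime → ℝ) (l : Filter ι)
    (u₀ : Spacetime → ℝ) : Prop :=
  ∀ h : Spacetime → ℝ, MemLp h 2 volume → HasCompactSupport h →
    Tendsto (fun i => ∫ x, u i x * h x) l (𝓝 (∫ x, u₀ x * h x))

/-- Weak convergence `f_i ⇀ f` in `H¹_loc`. By the embedding `f ↦ (f, ∂f)` of `H¹_loc` into
`(L²_loc)^5` this is the weak convergence in `L²_loc` of the functions and of their first
derivatives. -/
def WeakTendstoH1loc {ι : Type*} (f : ι → Spacetime → ℝ) (l : Filter ι)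
    (f₀ : Spacetime → ℝ) : Prop :=
  (∀ i, MemH1loc (f i)) ∧ MemH1loc f₀ ∧ WeakTendstoL2loc f l f₀ ∧
    ∀ μ, WeakTendstoL2loc (fun i => weakDeriv μ (f i)) l (weakDeriv μ f₀)

/-- The `H¹` norm of a test function. -/
def h1Norm (ψ : Test) : ℝ :=
  √((∫ x, ψ x ^ 2) + ∑ μ : Fin 4, ∫ x, (∂_{e μ} ψ) x ^ 2)

/-- `T` restricts to an element of `H⁻¹(Ω) = (H¹₀(Ω))*` of dual norm at most `C`. -/
def HMinusOneNormLE (Ω : Set Spacetime) (T : Distrib4) (C : ℝ) : Prop :=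
  ∀ ψ : Test, tsupport ψ ⊆ Ω → |T ψ| ≤ C * h1Norm ψ

/-- A set `S` of distributions is a pre-compact subset of `H⁻¹_loc(ℝ^{3+1})`: for every bounded
open `Ω` its elements restrict to elements of `H⁻¹(Ω)`, and they form a totally bounded (that is,
since `H⁻¹(Ω)` is complete, a relatively compact) subset of `H⁻¹(Ω)`. -/
def PrecompactHMinusOneLoc (S : Set Distrib4) : Prop :=
  ∀ Ω : Set Spacetime, IsOpen Ω → Bornology.IsBounded Ω →
    (∀ T ∈ S, ∃ C, HMinusOneNormLE Ω T C) ∧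
    ∀ δ > 0, ∃ t : Set Distrib4, t.Finite ∧ t ⊆ S ∧
      ∀ T ∈ S, ∃ T' ∈ t, HMinusOneNormLE Ω (T - T') δ

/-- Convergence in the sense of distributions of locally integrable functions. -/
def TendstoInDistributions {ι : Type*} (f : ι → Spacetime → ℝ) (l : Filter ι)
    (f₀ : Spacetime → ℝ) : Prop :=
  (∀ i, LocallyIntegrable (f i)) ∧ LocallyIntegrable f₀ ∧
    ∀ ψ : Test, Tendsto (fun i => toDistrib (f i) ψ) l (𝓝 (toDistrib f₀ ψ))

/-! ### The system of wave equations -/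

/-- The Minkowski metric `diag(-1, 1, 1, 1)`, which is its own inverse. -/
def minkowski : Matrix (Fin 4) (Fin 4) ℝ := Matrix.diagonal ![-1, 1, 1, 1]

/-- The null co-vectors: `m^{μν} ξ_μ ξ_ν = 0`. -/
def IsNull (ξ : Fin 4 → ℝ) : Prop := ∑ μ, ∑ ν, minkowski μ ν * ξ μ * ξ ν = 0

/-- The d'Alembertian `□ = m^{μν} ∂_μ ∂_ν` of a distribution. -/
def box (T : Distrib4) : Distrib4 := ∑ μ, ∑ ν, minkowski μ ν • ∂_{e μ} (∂_{e ν} T)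

/-- Values `p μ J = p_μ^J` of `∂φ`: the fibre of `T*ℝ^{3+1} ⊗ Tℝ^N`. -/
abbrev Grad (N : ℕ) : Type := Fin 4 → Fin N → ℝ

/-- Values of `(φ, ∂φ)`. -/
abbrev Jet (N : ℕ) : Type := (Fin N → ℝ) × Grad N

/-- The (weak) derivative `∂φ` of `φ = (φ^J)_J`. -/
def gradient {N : ℕ} (φ : Fin N → Spacetime → ℝ) (x : Spacetime) : Grad N :=
  fun μ J => weakDeriv μ (φ J) x

/-- The pair `(φ, ∂φ)`. -/
def jet {N : ℕ} (φ : Fin N → Spacetime → ℝ) (x : Spacetime) : Jet N :=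
  (fun J => φ J x, gradient φ x)

/-- `φ ∈ H¹_loc` is a weak solution of `□ φ^I = F^I(φ, ∂φ)`, `I = 1, …, N`. -/
def IsWeakSolution {N : ℕ} (F : Fin N → Jet N → ℝ) (φ : Fin N → Spacetime → ℝ) : Prop :=
  (∀ J, MemH1loc (φ J)) ∧
    ∀ I, LocallyIntegrable (fun x => F I (jet φ x)) ∧
      box (toDistrib (φ I)) = toDistrib (fun x => F I (jet φ x))

/-- `Q_f(p)`: the part quadratic in `∂φ = p` of the Taylor expansion of `f(φ, ∂φ)` at `0`. -/
def quadraticPart {N : ℕ} (f : Jet N → ℝ) (p : Grad N) : ℝ :=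
  iteratedFDeriv ℝ 2 f 0 (fun _ => ((0, p) : Jet N)) / 2

/-- The null condition for `F`, with the coefficients `A I J K μ ν = A^{μν}_{IJK}`. -/
structure NullCondition {N : ℕ} (F : Fin N → Jet N → ℝ)
    (A : Fin N → Fin N → Fin N → Fin 4 → Fin 4 → ℝ) : Prop where
  zero : ∀ I, F I 0 = 0
  deriv_zero : ∀ I, fderiv ℝ (F I) 0 = 0
  quadratic : ∀ I (p : Grad N),
    quadraticPart (F I) p = ∑ J, ∑ K, ∑ μ, ∑ ν, A I J K μ ν * p μ J * p ν K
  null : ∀ I J K (ξ : Fin 4 → ℝ), IsNull ξ → ∑ μ, ∑ ν, A I J K μ ν * ξ μ * ξ ν = 0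

/-- The first-order operator `(𝒯 s)_K = ∑ A^{μν}_{JK} ∂_ν s_μ^J` (here `A J K μ ν = A^{μν}_{JK}`). -/
def opT {N : ℕ} (A : Fin N → Fin N → Fin 4 → Fin 4 → ℝ) (s : Fin 4 → Fin N → Distrib4)
    (K : Fin N) : Distrib4 :=
  ∑ J, ∑ μ, ∑ ν, A J K μ ν • ∂_{e ν} (s μ J)

/-- The principal symbol of `𝒯` at the co-vector `ξ` (up to the constant factor that comes with
the normalization of the symbol): `∂_ν` is replaced by `ξ_ν`. -/
def symbolT {N : ℕ} (A : Fin N → Fin N → Fin 4 → Fin 4 → ℝ) (ξ : Fin 4 → ℝ) (s : Grad N)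
    (K : Fin N) : ℝ :=
  ∑ J, ∑ μ, ∑ ν, A J K μ ν * ξ ν * s μ J

/-- The operator cone of `𝒯`: the `s` that the symbol of `𝒯` annihilates at some non-zero
co-vector. -/
def operatorCone {N : ℕ} (A : Fin N → Fin N → Fin 4 → Fin 4 → ℝ) : Set (Grad N) :=
  {s | ∃ ξ : Fin 4 → ℝ, ξ ≠ 0 ∧ ∀ K, symbolT A ξ s K = 0}

/-- `∂φ` as a section of `T*ℝ^{3+1} ⊗ Tℝ^N` with distributional entries. -/
def distribGradient {N : ℕ} (φ : Fin N → Spacetime → ℝ) (μ : Fin 4) (J : Fin N) : Distrib4 :=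
  ∂_{e μ} (toDistrib (φ J))

end NullWave

end

open MeasureTheory Filter Topology NullWave

/-!
The quadratic form `Q(∂φ) = ∑ A^{μν}_{JK} ∂_μ φ^J ∂_ν φ^K` is a sum over `K` of products
`V_K · ∂φ^K`, where the flux `V_K^ν = ∑ A^{μν}_{JK} ∂_μ φ^J` has divergence
`∑ A^{μν}_{JK} ∂_μ ∂_ν φ^J = (𝒯 ∂φ)_K` (`isDivergence_flux`, `sum_flux_mul`). Along the family this
divergence is pre-compact in `H⁻¹_loc` and `∂φ^K` is a gradient, so that each product is weakly
continuous by the div-curl lemma (`tendsto_integral_divCurl`): for a test function `ψ`,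
integration by parts writes `∫ ψ V_n · ∂(f_n - f)` as a pairing of `-div V_n` with `ψ (f_n - f)`
minus `∫ V_n · ∂ψ (f_n - f)`. In the pairing, pre-compactness allows one to replace `div V_n` by
finitely many fixed distributions (`PrecompactHMinusOneLoc.tendsto_pairing_zero`), and
`ψ (f_n - f)` tends to `0` weakly in `H¹`. In the second term `f_n - f` tends to `0` strongly in
`L²_loc` by Rellich's theorem.

Rellich's theorem (`WeakTendstoH1loc.tendsto_integral_sq`) is proved by mollification. The `L²`
distance of a function to its mollification is controlled by its small translates
(`lintegral_mollify_sub_le`), hence by the gradient (`lintegral_translate_test_le`), whereas the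
mollifications of a weakly convergent sequence converge pointwise and boundedly. The same
mollification approximates localized `H¹` functions by test functions (`exists_test_approx`),
which the dual definition of `H⁻¹` requires. The uniform bounds come from the uniform boundedness
principle in `L²`. As weakly convergent nets may be unbounded, everything is done for sequences,
which suffice since the filter is countably generated.

For the system, a source quadratic in `(φ, ∂φ)` is `Q(∂φ)` plus terms with an undifferentiated
factor `φ^J` (`exists_quadraticForm_jet_eq`), and the latter are products of a strongly and a weakly
convergent factor (`tendsto_integral_test_mul_mul`).
-/

noncomputable section

namespace NullWave

/-! ### Square integrals -/

section SquareIntegrals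

variable {α : Type*} [MeasurableSpace α] {m : Measure α}

theorem sq_integral_mul_le {f g : α → ℝ} (hf : MemLp f 2 m) (hg : MemLp g 2 m) :
    (∫ x, f x * g x ∂m) ^ 2 ≤ (∫ x, f x ^ 2 ∂m) * ∫ x, g x ^ 2 ∂m := by
  have hfg : Integrable (fun x => f x * g x) m := hf.integrable_mul hg
  have key : ∀ t : ℝ, 0 ≤ (∫ x, g x ^ 2 ∂m) * (t * t) + (2 * ∫ x, f x * g x ∂m) * t
      + ∫ x, f x ^ 2 ∂m := by
    intro t
    have h : (∫ x, g x ^ 2 ∂m) * (t * t) + (2 * ∫ x, f x * g x ∂m) * t + ∫ x, f x ^ 2 ∂m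
        = ∫ x, (f x + t * g x) ^ 2 ∂m := by
      have : ∀ x, (f x + t * g x) ^ 2 = (t * t) * g x ^ 2 + (2 * t) * (f x * g x) + f x ^ 2 :=
        fun x => by ring
      simp_rw [this]
      have hsum : Integrable (fun x => (t * t) * g x ^ 2 + (2 * t) * (f x * g x)) m :=
        (hg.integrable_sq.const_mul _).add (hfg.const_mul _)
      rw [integral_add hsum hf.integrable_sq,
        integral_add (hg.integrable_sq.const_mul _) (hfg.const_mul _), integral_const_mul,
        integral_const_mul]
      ring
    rw [h]
    exact integral_nonneg fun x => sq_nonneg _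
  have := discrim_le_zero key
  unfold discrim at this
  nlinarith

theorem integral_add_sq_le {f g : α → ℝ} (hf : MemLp f 2 m) (hg : MemLp g 2 m) :
    ∫ x, (f x + g x) ^ 2 ∂m ≤ 2 * (∫ x, f x ^ 2 ∂m) + 2 * ∫ x, g x ^ 2 ∂m := by
  rw [← integral_const_mul, ← integral_const_mul,
    ← integral_add (hf.integrable_sq.const_mul _) (hg.integrable_sq.const_mul _)]
  refine integral_mono (hf.add hg).integrable_sq
    ((hf.integrable_sq.const_mul _).add (hg.integrable_sq.const_mul _)) fun x => ?_
  simp only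
  nlinarith [sq_nonneg (f x - g x)]

theorem ofReal_integral_sq {f : α → ℝ} (hf : MemLp f 2 m) :
    ENNReal.ofReal (∫ x, f x ^ 2 ∂m) = ∫⁻ x, ‖f x‖ₑ ^ 2 ∂m := by
  rw [ofReal_integral_eq_lintegral_ofReal hf.integrable_sq (ae_of_all _ fun x => sq_nonneg _)]
  refine lintegral_congr fun x => ?_
  rw [← ofReal_norm, ← ENNReal.ofReal_pow (norm_nonneg _), Real.norm_eq_abs, sq_abs]

theorem integral_sq_le_of_lintegral_le {f : α → ℝ} (hf : AEStronglyMeasurable f m) {C : ℝ}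
    (hC : 0 ≤ C) (h : ∫⁻ x, ‖f x‖ₑ ^ 2 ∂m ≤ ENNReal.ofReal C) : ∫ x, f x ^ 2 ∂m ≤ C := by
  rw [integral_eq_lintegral_of_nonneg_ae (ae_of_all _ fun x => sq_nonneg _) (hf.pow 2)]
  refine ENNReal.toReal_le_of_le_ofReal hC (le_of_eq_of_le (lintegral_congr fun x => ?_) h)
  rw [← ofReal_norm, ← ENNReal.ofReal_pow (norm_nonneg _), Real.norm_eq_abs, sq_abs]

theorem eLpNorm_two_sq (f : α → ℝ) : eLpNorm f 2 m ^ 2 = ∫⁻ x, ‖f x‖ₑ ^ 2 ∂m := by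
  rw [eLpNorm_eq_lintegral_rpow_enorm_toReal (by norm_num) (by norm_num)]
  simp only [ENNReal.toReal_ofNat, ENNReal.rpow_ofNat]
  rw [← ENNReal.rpow_natCast, ← ENNReal.rpow_mul]
  norm_num

/-- Strong `L²` convergence to `0` against an `L²`-bounded sequence. -/
theorem tendsto_integral_mul_zero {a b : ℕ → α → ℝ} (ha : ∀ n, MemLp (a n) 2 m)
    (hb : ∀ n, MemLp (b n) 2 m) {C : ℝ} (hC : ∀ n, ∫ x, a n x ^ 2 ∂m ≤ C)
    (h0 : Tendsto (fun n => ∫ x, b n x ^ 2 ∂m) atTop (𝓝 0)) :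
    Tendsto (fun n => ∫ x, a n x * b n x ∂m) atTop (𝓝 0) := by
  have h1 : Tendsto (fun n => (∫ x, a n x * b n x ∂m) ^ 2) atTop (𝓝 0) := by
    refine squeeze_zero (fun n => sq_nonneg _) (fun n => ?_) (by simpa using h0.const_mul C)
    refine (sq_integral_mul_le (ha n) (hb n)).trans ?_
    exact mul_le_mul_of_nonneg_right (hC n) (integral_nonneg fun x => sq_nonneg _)
  have h2 := (Real.continuous_sqrt.tendsto 0).comp h1
  rw [Real.sqrt_zero] at h2
  refine (tendsto_zero_iff_abs_tendsto_zero _).2 (h2.congr fun n => ?_)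
  simp [Real.sqrt_sq_eq_abs]

/-- Jensen's inequality for the square, integrated: the mean of the functions `k · y` with
respect to a probability measure is no larger in `L²` than they are. -/
theorem lintegral_enorm_integral_sq_le {β : Type*} [MeasurableSpace β] {p : Measure β}
    [IsProbabilityMeasure p] [SFinite m] {k : α → β → ℝ}
    (hk : AEStronglyMeasurable (Function.uncurry k) (m.prod p)) {C : ENNReal}
    (hC : ∀ᵐ y ∂p, ∫⁻ x, ‖k x y‖ₑ ^ 2 ∂m ≤ C) :
    ∫⁻ x, ‖∫ y, k x y ∂p‖ₑ ^ 2 ∂m ≤ C := by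
  calc ∫⁻ x, ‖∫ y, k x y ∂p‖ₑ ^ 2 ∂m ≤ ∫⁻ x, ∫⁻ y, ‖k x y‖ₑ ^ 2 ∂p ∂m := by
        refine lintegral_mono_ae ?_
        filter_upwards [hk.prodMk_left] with x hx
        calc ‖∫ y, k x y ∂p‖ₑ ^ 2 ≤ (eLpNorm (k x) 1 p) ^ 2 := by
              rw [eLpNorm_one_eq_lintegral_enorm]
              gcongr
              exact enorm_integral_le_lintegral_enorm _
          _ ≤ (eLpNorm (k x) 2 p) ^ 2 := by
              gcongr
              exact eLpNorm_le_eLpNorm_of_exponent_le (by norm_num) hx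
          _ = ∫⁻ y, ‖k x y‖ₑ ^ 2 ∂p := eLpNorm_two_sq _
    _ = ∫⁻ y, ∫⁻ x, ‖k x y‖ₑ ^ 2 ∂m ∂p := by
        refine lintegral_lintegral_swap ?_
        exact (hk.enorm.pow_const 2)
    _ ≤ ∫⁻ _, C ∂p := lintegral_mono_ae hC
    _ = C := by simp

end SquareIntegrals

/-! ### Local `L²` functions and weak derivatives -/

namespace MemL2loc

variable {f g : Spacetime → ℝ}

theorem locallyIntegrable (hf : MemL2loc f) : LocallyIntegrable f := by
  rw [locallyIntegrable_iff]
  intro K hK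
  have : IsFiniteMeasure (volume.restrict K) := ⟨by simpa using hK.measure_lt_top⟩
  exact (hf K hK).integrable (by norm_num)

theorem add (hf : MemL2loc f) (hg : MemL2loc g) : MemL2loc (fun x => f x + g x) :=
  fun K hK => (hf K hK).add (hg K hK)

theorem sub (hf : MemL2loc f) (hg : MemL2loc g) : MemL2loc (fun x => f x - g x) :=
  fun K hK => (hf K hK).sub (hg K hK)

theorem const_mul (hf : MemL2loc f) (c : ℝ) : MemL2loc (fun x => c * f x) :=
  fun K hK => (hf K hK).const_mul c

theorem sum {ι : Type*} (s : Finset ι) {f : ι → Spacetime → ℝ} (hf : ∀ i ∈ s, MemL2loc (f i)) :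
    MemL2loc (fun x => ∑ i ∈ s, f i x) :=
  fun K hK => memLp_finsetSum s fun i hi => hf i hi K hK

theorem locallyIntegrable_mul (hf : MemL2loc f) (hg : MemL2loc g) :
    LocallyIntegrable (fun x => f x * g x) := by
  rw [locallyIntegrable_iff]
  intro K hK
  exact (hf K hK).integrable_mul (hg K hK)

theorem memLp_indicator (hf : MemL2loc f) {K : Set Spacetime} (hK : IsCompact K) :
    MemLp (K.indicator f) 2 :=
  (memLp_indicator_iff_restrict hK.measurableSet).2 (hf K hK)

theorem memLp_mul (hf : MemL2loc f) {ψ : Spacetime → ℝ} (hψ : Continuous ψ)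
    (hs : HasCompactSupport ψ) : MemLp (fun x => ψ x * f x) 2 := by
  obtain ⟨C, hC⟩ := hψ.bounded_above_of_compact_support hs
  have h1 : MemLp (fun x => (tsupport ψ).indicator f x * ψ x) 2 :=
    MemLp.of_le_mul (c := C) (hf.memLp_indicator hs)
      ((hf.memLp_indicator hs).aestronglyMeasurable.mul hψ.aestronglyMeasurable)
      (ae_of_all _ fun x => by
        rw [norm_mul, mul_comm]
        exact mul_le_mul_of_nonneg_right (hC x) (norm_nonneg _))
  convert h1 using 2 with x
  by_cases hx : x ∈ tsupport ψ
  · simp [hx, mul_comm]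
  · simp [image_eq_zero_of_notMem_tsupport hx]

end MemL2loc

theorem _root_.MeasureTheory.MemLp.memL2loc {f : Spacetime → ℝ} (hf : MemLp f 2) : MemL2loc f :=
  fun _ _ => hf.restrict _

theorem toDistrib_apply {f : Spacetime → ℝ} (hf : LocallyIntegrable f) (ψ : Test) :
    toDistrib f ψ = ∫ x, ψ x * f x := by
  change TestFunction.integralAgainstBilinCLM (ContinuousLinearMap.mul ℝ ℝ) volume f ψ = _
  rw [TestFunction.integralAgainstBilinCLM_eq_integral]
  · rfl
  · exact hf.locallyIntegrableOn _

/-- The test function given by a smooth compactly supported function. -/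
def mkTest (χ : Spacetime → ℝ) (h : ContDiff ℝ ∞ χ) (hs : HasCompactSupport χ) : Test :=
  TestFunction.mk χ h hs (by simp)

@[simp] theorem mkTest_apply (χ : Spacetime → ℝ) (h : ContDiff ℝ ∞ χ) (hs : HasCompactSupport χ)
    (x : Spacetime) : mkTest χ h hs x = χ x := rfl

theorem lineDeriv_test_apply (ψ : Test) (v x : Spacetime) : (∂_{v} ψ) x = fderiv ℝ ψ x v := by
  change (TestFunction.lineDerivCLM ℝ v ψ : Test) x = _
  rw [TestFunction.lineDerivCLM_apply_of_le (by simp)]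
  exact (ψ.contDiff.differentiable (by simp)).differentiableAt.lineDeriv_eq_fderiv

theorem memLp_test (ψ : Test) : MemLp (fun x => ψ x) 2 :=
  ψ.continuous.memLp_of_hasCompactSupport ψ.hasCompactSupport

theorem isWeakDeriv_weakDeriv {f : Spacetime → ℝ} (hf : MemH1loc f) (μ : Fin 4) :
    IsWeakDeriv μ f (weakDeriv μ f) := by
  have h := hf.2 μ
  rw [weakDeriv, dif_pos h]
  exact h.choose_spec

theorem MemH1loc.memL2loc_weakDeriv {f : Spacetime → ℝ} (hf : MemH1loc f) (μ : Fin 4) :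
    MemL2loc (weakDeriv μ f) := (isWeakDeriv_weakDeriv hf μ).1

theorem IsWeakDeriv.integral_lineDeriv_mul {μ : Fin 4} {f g : Spacetime → ℝ} (hf : MemL2loc f)
    (h : IsWeakDeriv μ f g) (ψ : Test) :
    ∫ x, (∂_{e μ} ψ) x * f x = -∫ x, ψ x * g x := by
  have h1 := congrArg (fun T : Distrib4 => T ψ) h.2
  simp only [Distribution.lineDerivOp_apply_apply, map_neg] at h1
  rw [toDistrib_apply hf.locallyIntegrable, toDistrib_apply h.1.locallyIntegrable] at h1
  linarith

/-! ### Mollification -/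

/-- The mollification `φ ⋆ g` of `g` by the normalized bump function `φ`. -/
def mollify (φ : ContDiffBump (0 : Spacetime)) (g : Spacetime → ℝ) : Spacetime → ℝ :=
  convolution (φ.normed volume) g (ContinuousLinearMap.lsmul ℝ ℝ) volume

section Mollification

variable (φ : ContDiffBump (0 : Spacetime)) {g w : Spacetime → ℝ}

theorem mollify_apply (g : Spacetime → ℝ) (x : Spacetime) :
    mollify φ g x = ∫ y, φ.normed volume y * g (x - y) := by
  simp [mollify, convolution]

theorem mollify_apply' (g : Spacetime → ℝ) (x : Spacetime) :
    mollify φ g x = ∫ y, φ.normed volume (x - y) * g y := by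
  rw [mollify, convolution_eq_swap]
  simp

theorem contDiff_mollify (hg : LocallyIntegrable g) : ContDiff ℝ ∞ (mollify φ g) :=
  (φ.hasCompactSupport_normed (μ := volume)).contDiff_convolution_left _ φ.contDiff_normed hg

theorem integrable_normed_mul (hg : LocallyIntegrable g) (x : Spacetime) :
    Integrable (fun y => φ.normed volume y * g (x - y)) := by
  have := (φ.hasCompactSupport_normed (μ := volume)).convolutionExists_left (μ := volume)
    (ContinuousLinearMap.lsmul ℝ ℝ) (φ.continuous_normed (μ := volume)) hg x
  simpa [ConvolutionExistsAt] using this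

theorem mollify_eq_zero {R : ℝ} (hw : ∀ x, R < ‖x‖ → w x = 0) {x : Spacetime}
    (hx : R + φ.rOut < ‖x‖) : mollify φ w x = 0 := by
  rw [mollify_apply]
  refine integral_eq_zero_of_ae (ae_of_all _ fun y => ?_)
  by_cases hy : ‖y‖ < φ.rOut
  · have : R < ‖x - y‖ := by linarith [norm_sub_norm_le x y]
    simp [hw _ this]
  · have : y ∉ Function.support (φ.normed volume) := by
      rw [φ.support_normed_eq]; simpa using hy
    simp [Function.notMem_support.1 this]

/-- The probability measure whose density is the normalized bump function `φ`. -/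
def bumpMeasure : Measure Spacetime :=
  volume.withDensity fun y => (φ.normed volume y).toNNReal

theorem measurable_normed_toNNReal : Measurable fun y => (φ.normed volume y).toNNReal :=
  φ.continuous_normed.measurable.real_toNNReal

instance : IsProbabilityMeasure (bumpMeasure φ) := by
  constructor
  rw [bumpMeasure, withDensity_apply _ MeasurableSet.univ, Measure.restrict_univ]
  have := ofReal_integral_eq_lintegral_ofReal (φ.integrable_normed (μ := volume))
    (ae_of_all _ fun y => φ.nonneg_normed y)
  rw [φ.integral_normed] at this
  simpa [ENNReal.ofReal] using this.symm

theorem ae_bumpMeasure_norm_lt : ∀ᵐ y ∂bumpMeasure φ, ‖y‖ < φ.rOut := by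
  rw [bumpMeasure, ae_withDensity_iff (measurable_normed_toNNReal φ).coe_nnreal_ennreal]
  refine ae_of_all _ fun y hy => ?_
  have : y ∈ Function.support (φ.normed volume) := by
    intro h; exact hy (by simp [h])
  rw [φ.support_normed_eq] at this
  simpa using this

/-- A function is as close to its mollification as it is to its small translates. -/
theorem lintegral_mollify_sub_le (hg : LocallyIntegrable g) {C : ENNReal}
    (hC : ∀ y, ‖y‖ < φ.rOut → ∫⁻ x, ‖g (x - y) - g x‖ₑ ^ 2 ≤ C) :
    ∫⁻ x, ‖mollify φ g x - g x‖ₑ ^ 2 ≤ C := by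
  have h1 : ∀ x, mollify φ g x - g x = ∫ y, (g (x - y) - g x) ∂bumpMeasure φ := by
    intro x
    rw [bumpMeasure, integral_withDensity_eq_integral_smul (measurable_normed_toNNReal φ)]
    have : ∀ y, (φ.normed volume y).toNNReal • (g (x - y) - g x)
        = φ.normed volume y * g (x - y) - φ.normed volume y * g x := by
      intro y
      rw [NNReal.smul_def, Real.coe_toNNReal _ (φ.nonneg_normed y), smul_eq_mul, mul_sub]
    simp_rw [this]
    rw [integral_sub (integrable_normed_mul φ hg x) (φ.integrable_normed.mul_const _),
      integral_mul_const, φ.integral_normed, one_mul, mollify_apply]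
  simp_rw [h1]
  refine lintegral_enorm_integral_sq_le ?_ ((ae_bumpMeasure_norm_lt φ).mono hC)
  have hac : bumpMeasure φ ≪ volume := withDensity_absolutelyContinuous _ _
  have hm := hg.aestronglyMeasurable
  refine AEStronglyMeasurable.sub ?_ hm.comp_fst
  have := hm.comp_quasiMeasurePreserving
    (quasiMeasurePreserving_sub (volume : Measure Spacetime) volume)
  exact this.mono_ac ((Measure.AbsolutelyContinuous.refl _).prod hac)

/-- Translations are continuous in `L²`. -/
theorem tendsto_lintegral_translate (hg : MemLp g 2) :
    Tendsto (fun y : Spacetime => ∫⁻ x, ‖g (x - y) - g x‖ₑ ^ 2) (𝓝 0) (𝓝 0) := by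
  let T : Spacetime → C(Spacetime, Spacetime) := fun y => ⟨fun x => x - y, by fun_prop⟩
  have hT : Continuous T := by
    refine ContinuousMap.continuous_of_continuous_uncurry _ ?_
    change Continuous fun p : Spacetime × Spacetime => p.2 - p.1
    fun_prop
  have hmp : ∀ y, MeasurePreserving (T y) (volume : Measure Spacetime) volume :=
    fun y => measurePreserving_sub_right volume y
  have h1 := Filter.Tendsto.compMeasurePreservingLp (p := 2)
    (tendsto_const_nhds (x := hg.toLp g)) (hT.tendsto 0) hmp (hmp 0) (by norm_num)
  rw [tendsto_iff_edist_tendsto_0] at h1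
  have h2 := (ENNReal.continuous_pow 2).tendsto 0 |>.comp h1
  rw [zero_pow two_ne_zero] at h2
  refine h2.congr fun y => ?_
  have h0 : Lp.compMeasurePreserving (T 0) (hmp 0) (hg.toLp g) = hg.toLp g := by
    rw [Lp.toLp_compMeasurePreserving]
    congr 1
    ext x
    simp [T]
  simp only [Function.comp_apply]
  rw [h0, Lp.toLp_compMeasurePreserving, Lp.edist_toLp_toLp, eLpNorm_two_sq]
  rfl

/-- Mollification commutes with weak derivatives. -/
theorem fderiv_mollify {μ : Fin 4} (hw : LocallyIntegrable w)
    (h : ∀ ψ : Test, ∫ x, (∂_{e μ} ψ) x * w x = -∫ x, ψ x * g x) (x : Spacetime) :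
    fderiv ℝ (mollify φ w) x (e μ) = mollify φ g x := by
  have h1 := (φ.hasCompactSupport_normed (μ := volume)).hasFDerivAt_convolution_left (μ := volume)
    (ContinuousLinearMap.lsmul ℝ ℝ) (φ.contDiff_normed (n := 1)) hw x
  have h2 := (φ.hasCompactSupport_normed (μ := volume)).fderiv ℝ |>.convolutionExists_left
    (μ := volume) ((ContinuousLinearMap.lsmul ℝ ℝ).precompL Spacetime)
    ((φ.contDiff_normed (n := 1)).continuous_fderiv (by simp)) hw x
  -- the test function `y ↦ φ (x - y)` carries the derivative over to `w`
  have hcs : HasCompactSupport fun y => φ.normed volume (x - y) :=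
    φ.hasCompactSupport_normed.comp_homeomorph (Homeomorph.subLeft x)
  have hcd : ContDiff ℝ ∞ fun y => φ.normed volume (x - y) :=
    φ.contDiff_normed.comp (contDiff_const.sub contDiff_id)
  have h3 := h (mkTest _ hcd hcs)
  have h4 : ∀ y, (∂_{e μ} (mkTest _ hcd hcs)) y = -fderiv ℝ (φ.normed volume) (x - y) (e μ) := by
    intro y
    rw [lineDeriv_test_apply]
    have h5 : HasFDerivAt (fun y => φ.normed volume (x - y))
        ((fderiv ℝ (φ.normed volume) (x - y)).comp (-ContinuousLinearMap.id ℝ Spacetime)) y :=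
      HasFDerivAt.comp y
        ((φ.contDiff_normed (n := 1)).differentiable (by simp) (x - y)).hasFDerivAt
        ((hasFDerivAt_id y).const_sub x)
    have h6 : fderiv ℝ (mkTest _ hcd hcs) y = _ := h5.fderiv
    rw [h6]
    simp
  simp_rw [h4, mkTest_apply, neg_mul, integral_neg, neg_inj] at h3
  rw [mollify, h1.fderiv, mollify_apply', ← h3, convolution_def,
    ContinuousLinearMap.integral_apply h2, ← integral_sub_left_eq_self _ volume x]
  simp [ContinuousLinearMap.precompL_apply]

end Mollification

/-- A compactly supported `H¹` function is a limit in `H¹` of test functions supported in a fixed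
ball. -/
theorem exists_test_approx {w : Spacetime → ℝ} {g : Fin 4 → Spacetime → ℝ} (hw : MemLp w 2) (hg : ∀ μ, MemLp (g μ) 2)
    {R : ℝ} (hR : ∀ x, R < ‖x‖ → w x = 0)
    (h : ∀ μ, ∀ ψ : Test, ∫ x, (∂_{e μ} ψ) x * w x = -∫ x, ψ x * g μ x) {ε : ℝ} (hε : 0 < ε) :
    ∃ θ : Test, (∀ x, R + 1 < ‖x‖ → θ x = 0) ∧ ∫ x, (θ x - w x) ^ 2 ≤ ε ∧
      ∀ μ, ∫ x, ((∂_{e μ} θ) x - g μ x) ^ 2 ≤ ε := by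
  have htr : ∀ {f : Spacetime → ℝ}, MemLp f 2 → ∀ᶠ r in 𝓝[>] (0 : ℝ), ∀ y : Spacetime,
      ‖y‖ < r → ∫⁻ x, ‖f (x - y) - f x‖ₑ ^ 2 ≤ ENNReal.ofReal ε := by
    intro f hf
    have h1 := (tendsto_lintegral_translate hf).eventually
      (Iic_mem_nhds (ENNReal.ofReal_pos.2 hε))
    obtain ⟨r, hr, hr'⟩ := Metric.eventually_nhds_iff.1 h1
    filter_upwards [Ioo_mem_nhdsGT hr] with s hs y hy
    exact hr' (by simpa using hy.trans hs.2)
  obtain ⟨r, hr0, hr1, hrw, hrg⟩ := ((eventually_mem_nhdsWithin (a := (0 : ℝ))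
    (s := Set.Ioi 0)).and ((eventually_nhdsWithin_of_eventually_nhds
    (Iio_mem_nhds zero_lt_one)).and ((htr hw).and (eventually_all.2 fun μ => htr (hg μ))))).exists
  let φ : ContDiffBump (0 : Spacetime) := ⟨r / 2, r, half_pos hr0, half_lt_self hr0⟩
  have hwl := hw.locallyIntegrable (by norm_num)
  have hgl := fun μ => (hg μ).locallyIntegrable (by norm_num)
  have hzero : ∀ x, R + 1 < ‖x‖ → mollify φ w x = 0 := fun x hx =>
    mollify_eq_zero φ hR (lt_trans (by simpa [φ] using hr1) hx)
  let θ : Test := mkTest (mollify φ w) (contDiff_mollify φ hwl)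
    (HasCompactSupport.intro (isCompact_closedBall 0 (R + 1)) fun x hx => hzero x (by simpa using hx))
  have hconv : ∀ {f : Spacetime → ℝ}, LocallyIntegrable f →
      ∫⁻ x, ‖mollify φ f x - f x‖ₑ ^ 2 ≤ ENNReal.ofReal ε →
      ∫ x, (mollify φ f x - f x) ^ 2 ≤ ε := by
    intro f hf hle
    exact integral_sq_le_of_lintegral_le
      ((contDiff_mollify φ hf).continuous.aestronglyMeasurable.sub hf.aestronglyMeasurable) hε.le hle
  refine ⟨θ, hzero, hconv hwl (lintegral_mollify_sub_le φ hwl hrw), fun μ => ?_⟩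
  have : ∀ x, (∂_{e μ} θ) x = mollify φ (g μ) x := fun x => by
    rw [lineDeriv_test_apply]
    exact fderiv_mollify φ hwl (h μ) x
  simp_rw [this]
  exact hconv (hgl μ) (lintegral_mollify_sub_le φ (hgl μ) (hrg μ))

/-! ### Uniform boundedness and Rellich compactness of test functions -/

/-- The uniform boundedness principle in `L²`, for square integrals. -/
theorem exists_integral_sq_le_of_pairings_bounded {α ι : Type*} [MeasurableSpace α] {m : Measure α}
    {u : ι → α → ℝ} (hu : ∀ i, MemLp (u i) 2 m)
    (hb : ∀ h : α → ℝ, MemLp h 2 m → ∃ C, ∀ i, |∫ x, u i x * h x ∂m| ≤ C) :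
    ∃ C, ∀ i, ∫ x, u i x ^ 2 ∂m ≤ C := by
  have hinner : ∀ i (h : Lp ℝ 2 m), inner ℝ ((hu i).toLp (u i)) h = ∫ x, u i x * h x ∂m := by
    intro i h
    rw [L2.inner_def]
    refine integral_congr_ae ?_
    filter_upwards [(hu i).coeFn_toLp] with x hx
    simp [hx, mul_comm]
  obtain ⟨C, hC⟩ := banach_steinhaus (g := fun i => innerSL ℝ ((hu i).toLp (u i))) fun h => by
    obtain ⟨C, hC⟩ := hb h (Lp.memLp h)
    exact ⟨C, fun i => by
      rw [innerSL_apply_apply, hinner]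
      exact hC i⟩
  refine ⟨C ^ 2, fun i => ?_⟩
  have h1 : ∫ x, u i x ^ 2 ∂m = ‖(hu i).toLp (u i)‖ ^ 2 := by
    rw [← real_inner_self_eq_norm_sq, hinner]
    refine integral_congr_ae ?_
    filter_upwards [(hu i).coeFn_toLp] with x hx
    simp [hx, sq]
  rw [h1]
  have h2 := hC i
  rw [innerSL_apply_norm] at h2
  exact pow_le_pow_left₀ (norm_nonneg _) h2 2

theorem fderiv_test_sq_le (θ : Test) (x y : Spacetime) :
    (fderiv ℝ θ x y) ^ 2 ≤ ‖y‖ ^ 2 * ∑ μ, (∂_{e μ} θ) x ^ 2 := by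
  have h1 : y = ∑ μ, y μ • e μ := by
    ext ν
    simp [e, Finset.sum_apply, Pi.single_apply]
  have h2 : fderiv ℝ θ x y = ∑ μ, y μ * (∂_{e μ} θ) x := by
    conv_lhs => rw [h1]
    simp [lineDeriv_test_apply]
  rw [h2, EuclideanSpace.real_norm_sq_eq]
  exact Finset.sum_mul_sq_le_sq_mul_sq _ _ _

instance : IsProbabilityMeasure ((volume : Measure ℝ).restrict (Set.Ioc 0 1)) :=
  ⟨by simp⟩

/-- A translate of a test function differs from it in `L²` by at most the length of the
translation times the `L²` norm of the gradient. -/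
theorem lintegral_translate_test_le (θ : Test) (y : Spacetime) :
    ∫⁻ x, ‖θ (x - y) - θ x‖ₑ ^ 2 ≤
      ENNReal.ofReal (‖y‖ ^ 2 * ∑ μ, ∫ x, (∂_{e μ} θ) x ^ 2) := by
  have hd : Differentiable ℝ θ := θ.contDiff.differentiable (by simp)
  have hc : Continuous (fderiv ℝ θ) := θ.contDiff.continuous_fderiv (by simp)
  have hk : Continuous fun z : Spacetime × ℝ => fderiv ℝ θ (z.1 - z.2 • y) (-y) := by fun_prop
  have h1 : ∀ x, θ (x - y) - θ x
      = ∫ s in Set.Ioc (0 : ℝ) 1, fderiv ℝ θ (x - s • y) (-y) := by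
    intro x
    have hder : ∀ s : ℝ, HasDerivAt (fun s : ℝ => θ (x - s • y))
        (fderiv ℝ θ (x - s • y) (-y)) s := by
      intro s
      have h2 : HasDerivAt (fun s : ℝ => x - s • y) (-y) s := by
        simpa using ((hasDerivAt_id s).smul_const y).const_sub x
      exact (hd _).hasFDerivAt.comp_hasDerivAt s h2
    rw [← intervalIntegral.integral_of_le zero_le_one,
      intervalIntegral.integral_eq_sub_of_hasDerivAt (fun s _ => hder s)
        ((hk.comp (Continuous.prodMk_right x)).intervalIntegrable _ _)]
    simp
  simp_rw [h1]
  refine lintegral_enorm_integral_sq_le (k := fun x (s : ℝ) => fderiv ℝ θ (x - s • y) (-y))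
    hk.aestronglyMeasurable (ae_of_all _ fun s => ?_)
  rw [lintegral_sub_right_eq_self (fun x => ‖fderiv ℝ θ x (-y)‖ₑ ^ 2) (s • y)]
  have hm : MemLp (fun x => fderiv ℝ θ x (-y)) 2 :=
    Continuous.memLp_of_hasCompactSupport (by fun_prop)
      (θ.hasCompactSupport.fderiv_apply ℝ (-y))
  rw [← ofReal_integral_sq hm]
  refine ENNReal.ofReal_le_ofReal ?_
  rw [← integral_finsetSum _ fun μ _ => (memLp_test _).integrable_sq, ← integral_const_mul]
  refine integral_mono hm.integrable_sq
    ((integrable_finsetSum _ fun μ _ => (memLp_test _).integrable_sq).const_mul _) fun x => ?_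
  simpa using fderiv_test_sq_le θ x (-y)

/-- Rellich's compactness theorem for test functions supported in a fixed ball: weak convergence
to `0` with bounded gradients is strong convergence in `L²`. At a small scale a function is
close to its mollification, and the mollifications converge pointwise and boundedly. -/
theorem tendsto_integral_sq_of_weak {θ : ℕ → Test} {R C : ℝ}
    (hR : ∀ n x, R < ‖x‖ → θ n x = 0) (hC : ∀ n, ∫ x, θ n x ^ 2 ≤ C)
    (hC' : ∀ n, ∑ μ, ∫ x, (∂_{e μ} (θ n)) x ^ 2 ≤ C)
    (hw : ∀ h : Spacetime → ℝ, MemLp h 2 → Tendsto (fun n => ∫ x, θ n x * h x) atTop (𝓝 0)) :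
    Tendsto (fun n => ∫ x, θ n x ^ 2) atTop (𝓝 0) := by
  have hl : ∀ n, LocallyIntegrable (fun x => θ n x) := fun n =>
    (memLp_test (θ n)).locallyIntegrable (by norm_num)
  have hC0 : 0 ≤ C := (integral_nonneg fun x => sq_nonneg _).trans (hC 0)
  refine Metric.tendsto_atTop.2 fun ε hε => ?_
  obtain ⟨δ, hδ, hδC⟩ : ∃ δ > 0, δ ^ 2 * C < ε / 4 := by
    have h1 : Tendsto (fun δ : ℝ => δ ^ 2 * C) (𝓝[>] 0) (𝓝 0) := by
      have : Continuous fun δ : ℝ => δ ^ 2 * C := by fun_prop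
      simpa using (this.tendsto 0).mono_left nhdsWithin_le_nhds
    exact ((eventually_mem_nhdsWithin (a := (0 : ℝ)) (s := Set.Ioi 0)).and
      (h1.eventually_lt_const (by positivity : 0 < ε / 4))).exists
  let φ : ContDiffBump (0 : Spacetime) := ⟨δ / 2, δ, half_pos hδ, half_lt_self hδ⟩
  have hφx : ∀ x, MemLp (fun y => φ.normed volume (x - y)) 2 := fun x =>
    Continuous.memLp_of_hasCompactSupport (by have := φ.continuous_normed (μ := volume); fun_prop)
      ((φ.hasCompactSupport_normed (μ := volume)).comp_homeomorph (Homeomorph.subLeft x))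
  have hmc : ∀ n, Continuous (mollify φ (θ n)) := fun n => (contDiff_mollify φ (hl n)).continuous
  have hm0 : ∀ n x, R + δ < ‖x‖ → mollify φ (θ n) x = 0 := fun n x hx =>
    mollify_eq_zero φ (hR n) hx
  have hmm : ∀ n, MemLp (mollify φ (θ n)) 2 := fun n =>
    (hmc n).memLp_of_hasCompactSupport
      (HasCompactSupport.intro (isCompact_closedBall 0 (R + δ)) fun x hx =>
        hm0 n x (by simpa using hx))
  have hclose : ∀ n, ∫ x, (mollify φ (θ n) x - θ n x) ^ 2 ≤ δ ^ 2 * C := by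
    intro n
    refine integral_sq_le_of_lintegral_le
      ((hmc n).aestronglyMeasurable.sub (θ n).continuous.aestronglyMeasurable) (by positivity)
      (lintegral_mollify_sub_le φ (hl n) fun y hy => ?_)
    refine (lintegral_translate_test_le (θ n) y).trans (ENNReal.ofReal_le_ofReal ?_)
    gcongr
    exact hC' n
  have hbd : ∀ n x, mollify φ (θ n) x ^ 2 ≤ (∫ y, φ.normed volume y ^ 2) * C := by
    intro n x
    rw [mollify_apply']
    refine (sq_integral_mul_le (hφx x) (memLp_test (θ n))).trans ?_
    rw [integral_sub_left_eq_self (fun y => φ.normed volume y ^ 2) volume x]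
    exact mul_le_mul_of_nonneg_left (hC n) (integral_nonneg fun y => sq_nonneg _)
  have hlim : Tendsto (fun n => ∫ x, mollify φ (θ n) x ^ 2) atTop (𝓝 (∫ _ : Spacetime, (0 : ℝ))) := by
    refine tendsto_integral_of_dominated_convergence
      ((Metric.closedBall (0 : Spacetime) (R + δ)).indicator
        fun _ => (∫ y, φ.normed volume y ^ 2) * C)
      (fun n => ((hmc n).pow 2).aestronglyMeasurable) ?_ (fun n => ae_of_all _ fun x => ?_)
      (ae_of_all _ fun x => ?_)
    · exact (integrable_indicator_iff measurableSet_closedBall).2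
        (integrableOn_const (isCompact_closedBall _ _).measure_lt_top.ne)
    · rw [Real.norm_eq_abs, abs_of_nonneg (sq_nonneg _)]
      by_cases hx : x ∈ Metric.closedBall (0 : Spacetime) (R + δ)
      · rw [Set.indicator_of_mem hx]
        exact hbd n x
      · rw [Set.indicator_of_notMem hx, hm0 n x (by simpa using hx)]
        simp
    · have h1 := (hw _ (hφx x)).pow 2
      rw [zero_pow two_ne_zero] at h1
      refine h1.congr fun n => ?_
      rw [mollify_apply']
      simp_rw [mul_comm]
  rw [integral_zero] at hlim
  obtain ⟨n₀, hn₀⟩ := eventually_atTop.1 (hlim.eventually_lt_const (by positivity : 0 < ε / 4))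
  refine ⟨n₀, fun n hn => ?_⟩
  rw [Real.dist_eq, sub_zero, abs_of_nonneg (integral_nonneg fun x => sq_nonneg _)]
  have h2 := integral_add_sq_le (hmm n) ((memLp_test (θ n)).sub (hmm n))
  have h3 : ∀ x, (mollify φ (θ n) x + ((fun x => θ n x) - mollify φ (θ n)) x) ^ 2 = θ n x ^ 2 :=
    fun x => by simp
  have h4 : ∀ x, ((fun x => θ n x) - mollify φ (θ n)) x ^ 2 = (mollify φ (θ n) x - θ n x) ^ 2 :=
    fun x => by simp only [Pi.sub_apply]; ring
  simp_rw [h3, h4] at h2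
  linarith [hclose n, hn₀ n hn]

/-! ### Weakly convergent sequences in `H¹_loc` -/

theorem integrable_test_mul {f : Spacetime → ℝ} (hf : LocallyIntegrable f) (ψ : Test) :
    Integrable (fun x => ψ x * f x) :=
  hf.integrable_smul_left_of_hasCompactSupport ψ.continuous ψ.hasCompactSupport

theorem MemL2loc.integrable_test_mul {f : Spacetime → ℝ} (hf : MemL2loc f) (ψ : Test) :
    Integrable (fun x => ψ x * f x) :=
  NullWave.integrable_test_mul hf.locallyIntegrable ψ

theorem MemL2loc.memLp_test_mul {f : Spacetime → ℝ} (hf : MemL2loc f) (ψ : Test) :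
    MemLp (fun x => ψ x * f x) 2 :=
  hf.memLp_mul ψ.continuous ψ.hasCompactSupport

/-- `u ∈ L²_loc` has the weak gradient `G`, with the integration by parts formula spelled out. -/
def HasWeakGrad (u : Spacetime → ℝ) (G : Fin 4 → Spacetime → ℝ) : Prop :=
  MemL2loc u ∧ ∀ μ, MemL2loc (G μ) ∧
    ∀ χ : Test, ∫ x, (∂_{e μ} χ) x * u x = -∫ x, χ x * G μ x

theorem MemH1loc.hasWeakGrad {f : Spacetime → ℝ} (hf : MemH1loc f) :
    HasWeakGrad f (fun μ => weakDeriv μ f) :=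
  ⟨hf.1, fun μ => ⟨hf.memL2loc_weakDeriv μ,
    fun χ => (isWeakDeriv_weakDeriv hf μ).integral_lineDeriv_mul hf.1 χ⟩⟩

theorem HasWeakGrad.sub {u v : Spacetime → ℝ} {G H : Fin 4 → Spacetime → ℝ}
    (hu : HasWeakGrad u G) (hv : HasWeakGrad v H) :
    HasWeakGrad (fun x => u x - v x) (fun μ x => G μ x - H μ x) := by
  refine ⟨hu.1.sub hv.1, fun μ => ⟨(hu.2 μ).1.sub (hv.2 μ).1, fun χ => ?_⟩⟩
  simp_rw [mul_sub]
  rw [integral_sub (hu.1.integrable_test_mul _) (hv.1.integrable_test_mul _),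
    integral_sub ((hu.2 μ).1.integrable_test_mul _) ((hv.2 μ).1.integrable_test_mul _),
    (hu.2 μ).2, (hv.2 μ).2]
  ring

/-- The Leibniz rule for weak derivatives. -/
theorem HasWeakGrad.test_mul {u : Spacetime → ℝ} {G : Fin 4 → Spacetime → ℝ}
    (hu : HasWeakGrad u G) (ψ : Test) :
    HasWeakGrad (fun x => ψ x * u x) (fun μ x => ψ x * G μ x + (∂_{e μ} ψ) x * u x) := by
  refine ⟨(hu.1.memLp_test_mul ψ).memL2loc, fun μ =>
    ⟨((hu.2 μ).1.memLp_test_mul ψ).memL2loc.add (hu.1.memLp_test_mul _).memL2loc, fun χ => ?_⟩⟩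
  let χψ : Test := mkTest (fun x => χ x * ψ x) (χ.contDiff.mul ψ.contDiff)
    χ.hasCompactSupport.mul_right
  have h1 : ∀ x, (∂_{e μ} χψ) x = χ x * (∂_{e μ} ψ) x + ψ x * (∂_{e μ} χ) x := by
    intro x
    simp_rw [lineDeriv_test_apply]
    have h2 : fderiv ℝ χψ x = _ := fderiv_fun_mul
      (χ.contDiff.differentiable (by simp) x) (ψ.contDiff.differentiable (by simp) x)
    rw [h2]
    simp
  have h3 := (hu.2 μ).2 χψ
  have hi1 : Integrable (fun x => χ x * ((∂_{e μ} ψ) x * u x)) :=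
    (hu.1.memLp_test_mul _).memL2loc.integrable_test_mul χ
  have hi2 : Integrable (fun x => (∂_{e μ} χ) x * (ψ x * u x)) :=
    (hu.1.memLp_test_mul _).memL2loc.integrable_test_mul _
  have hi3 : Integrable (fun x => χ x * (ψ x * G μ x)) :=
    ((hu.2 μ).1.memLp_test_mul _).memL2loc.integrable_test_mul _
  have h4 : ∫ x, (∂_{e μ} χψ) x * u x
      = (∫ x, χ x * ((∂_{e μ} ψ) x * u x)) + ∫ x, (∂_{e μ} χ) x * (ψ x * u x) := by
    rw [← integral_add hi1 hi2]
    refine integral_congr_ae (ae_of_all _ fun x => ?_)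
    simp only [h1]
    ring
  have h5 : ∫ x, χψ x * G μ x = ∫ x, χ x * (ψ x * G μ x) :=
    integral_congr_ae (ae_of_all _ fun x => by simp [χψ, mul_assoc])
  rw [h4, h5] at h3
  simp_rw [mul_add]
  rw [integral_add hi3 hi1]
  linarith

theorem exists_integral_sq_le_of_weak {α : Type*} [MeasurableSpace α] {m : Measure α}
    {u : ℕ → α → ℝ} (hu : ∀ n, MemLp (u n) 2 m)
    (hb : ∀ h : α → ℝ, MemLp h 2 m → ∃ c, Tendsto (fun n => ∫ x, u n x * h x ∂m) atTop (𝓝 c)) :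
    ∃ C, ∀ n, ∫ x, u n x ^ 2 ∂m ≤ C := by
  refine exists_integral_sq_le_of_pairings_bounded hu fun h hh => ?_
  obtain ⟨c, hc⟩ := hb h hh
  obtain ⟨C, hC⟩ := hc.abs.bddAbove_range
  exact ⟨C, fun n => hC ⟨n, rfl⟩⟩

namespace WeakTendstoL2loc

variable {u : ℕ → Spacetime → ℝ} {u₀ : Spacetime → ℝ}

theorem exists_integral_sq_le (h : WeakTendstoL2loc u atTop u₀) (hu : ∀ n, MemL2loc (u n))
    {K : Set Spacetime} (hK : IsCompact K) :
    ∃ C, ∀ n, ∫ x, K.indicator (u n) x ^ 2 ≤ C := by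
  refine exists_integral_sq_le_of_weak (fun n => (hu n).memLp_indicator hK) fun g hg => ?_
  refine ⟨_, (h (K.indicator g) (hg.indicator hK.measurableSet)
    (HasCompactSupport.intro hK fun x hx => Set.indicator_of_notMem hx _)).congr fun n => ?_⟩
  refine integral_congr_ae (ae_of_all _ fun x => ?_)
  by_cases hx : x ∈ K <;> simp [hx]

theorem tendsto_integral_test_mul (h : WeakTendstoL2loc u atTop u₀) (ψ : Test)
    {g : Spacetime → ℝ} (hg : MemL2loc g) :
    Tendsto (fun n => ∫ x, ψ x * g x * u n x) atTop (𝓝 (∫ x, ψ x * g x * u₀ x)) := by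
  have := h _ (hg.memLp_test_mul ψ) ψ.hasCompactSupport.mul_right
  simpa only [mul_comm] using this

theorem tendsto_integral_test_sub (h : WeakTendstoL2loc u atTop u₀) (hu : ∀ n, MemL2loc (u n))
    (hu₀ : MemL2loc u₀) (ψ : Test) {g : Spacetime → ℝ} (hg : MemL2loc g) :
    Tendsto (fun n => ∫ x, ψ x * (u n x - u₀ x) * g x) atTop (𝓝 0) := by
  have h1 := (h.tendsto_integral_test_mul ψ hg).sub_const (∫ x, ψ x * g x * u₀ x)
  rw [sub_self] at h1
  refine h1.congr fun n => ?_
  have hi : ∀ {v : Spacetime → ℝ}, MemL2loc v → Integrable fun x => ψ x * g x * v x := fun hv => by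
    simpa only [mul_assoc] using integrable_test_mul (hg.locallyIntegrable_mul hv) ψ
  rw [← integral_sub (hi (hu n)) (hi hu₀)]
  exact integral_congr_ae (ae_of_all _ fun x => by ring)

end WeakTendstoL2loc

/-- The localization `ψ (f_n - f)` of a null sequence of `H¹_loc` is approximated in `H¹` by test
functions, supported in a fixed ball, that converge to `0` weakly in `H¹` and strongly in `L²`. -/
theorem WeakTendstoH1loc.exists_test_approx {f : ℕ → Spacetime → ℝ} {f₀ : Spacetime → ℝ}
    (h : WeakTendstoH1loc f atTop f₀) (ψ : Test) :
    ∃ (R : ℝ) (θ : ℕ → Test), (∀ x, R < ‖x‖ → ψ x = 0) ∧ (∀ n x, R < ‖x‖ → θ n x = 0) ∧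
      Tendsto (fun n => ∫ x, (θ n x - ψ x * (f n x - f₀ x)) ^ 2) atTop (𝓝 0) ∧
      (∀ μ, Tendsto (fun n => ∫ x, ((∂_{e μ} (θ n)) x -
        (ψ x * (weakDeriv μ (f n) x - weakDeriv μ f₀ x) +
          (∂_{e μ} ψ) x * (f n x - f₀ x))) ^ 2) atTop (𝓝 0)) ∧
      (∀ μ g, MemLp g 2 → Tendsto (fun n => ∫ x, (∂_{e μ} (θ n)) x * g x) atTop (𝓝 0)) ∧
      (∃ C, ∀ n, h1Norm (θ n) ≤ C) ∧ Tendsto (fun n => ∫ x, θ n x ^ 2) atTop (𝓝 0) := by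
  obtain ⟨hf, hf₀, hw, hwd⟩ := h
  obtain ⟨R, hR⟩ := ψ.hasCompactSupport.isBounded.subset_closedBall 0
  have hψR : ∀ x, R < ‖x‖ → ψ x = 0 := fun x hx =>
    image_eq_zero_of_notMem_tsupport fun hx' => by
      have := hR hx'
      rw [mem_closedBall_zero_iff] at this
      linarith
  have hgrad := fun n => ((hf n).hasWeakGrad.sub hf₀.hasWeakGrad).test_mul ψ
  have hsub : ∀ n, MemL2loc (fun x => f n x - f₀ x) := fun n => (hf n).1.sub hf₀.1
  have hsub' : ∀ n μ, MemL2loc (fun x => weakDeriv μ (f n) x - weakDeriv μ f₀ x) := fun n μ =>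
    ((hf n).memL2loc_weakDeriv μ).sub (hf₀.memL2loc_weakDeriv μ)
  have hwm : ∀ n, MemLp (fun x => ψ x * (f n x - f₀ x)) 2 := fun n => (hsub n).memLp_test_mul ψ
  have hgm : ∀ n μ, MemLp (fun x => ψ x * (weakDeriv μ (f n) x - weakDeriv μ f₀ x) +
      (∂_{e μ} ψ) x * (f n x - f₀ x)) 2 := fun n μ =>
    ((hsub' n μ).memLp_test_mul ψ).add ((hsub n).memLp_test_mul _)
  choose θ hθ0 hθ1 hθ2 using fun n : ℕ => NullWave.exists_test_approx (hwm n) (hgm n)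
    (fun x hx => by rw [hψR x hx, zero_mul]) (fun μ => ((hgrad n).2 μ).2)
    (Nat.one_div_pos_of_nat (α := ℝ) (n := n))
  have hs1 : Tendsto (fun n => ∫ x, (θ n x - ψ x * (f n x - f₀ x)) ^ 2) atTop (𝓝 0) :=
    squeeze_zero (fun n => integral_nonneg fun x => sq_nonneg _) hθ1
      tendsto_one_div_add_atTop_nhds_zero_nat
  have hs2 : ∀ μ, Tendsto (fun n => ∫ x, ((∂_{e μ} (θ n)) x -
        (ψ x * (weakDeriv μ (f n) x - weakDeriv μ f₀ x) +
          (∂_{e μ} ψ) x * (f n x - f₀ x))) ^ 2) atTop (𝓝 0) := fun μ =>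
    squeeze_zero (fun n => integral_nonneg fun x => sq_nonneg _) (fun n => hθ2 n μ)
      tendsto_one_div_add_atTop_nhds_zero_nat
  -- an `L²` approximation of a weak null sequence is a weak null sequence
  have htransfer : ∀ {a b : ℕ → Spacetime → ℝ} (_ : ∀ n, MemLp (a n) 2) (_ : ∀ n, MemLp (b n) 2)
      (_ : Tendsto (fun n => ∫ x, (a n x - b n x) ^ 2) atTop (𝓝 0)) {g : Spacetime → ℝ}
      (_ : MemLp g 2) (_ : Tendsto (fun n => ∫ x, b n x * g x) atTop (𝓝 0)),
      Tendsto (fun n => ∫ x, a n x * g x) atTop (𝓝 0) := by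
    intro a b ha hb hab g hg hbg
    have h1 := (tendsto_integral_mul_zero (fun _ => hg) (fun n => (ha n).sub (hb n))
      (fun _ => le_rfl) hab).add hbg
    rw [zero_add] at h1
    refine h1.congr fun n => ?_
    have hi1 : Integrable fun x => g x * (a n - b n) x := hg.integrable_mul ((ha n).sub (hb n))
    have hi2 : Integrable fun x => b n x * g x := (hb n).integrable_mul hg
    rw [← integral_add hi1 hi2]
    refine integral_congr_ae (ae_of_all _ fun x => ?_)
    simp only [Pi.sub_apply]
    ring
  have hθw : ∀ g, MemLp g 2 → Tendsto (fun n => ∫ x, θ n x * g x) atTop (𝓝 0) := fun g hg =>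
    htransfer (fun n => memLp_test _) hwm hs1 hg
      (hw.tendsto_integral_test_sub (fun n => (hf n).1) hf₀.1 ψ hg.memL2loc)
  have hθdw : ∀ μ g, MemLp g 2 → Tendsto (fun n => ∫ x, (∂_{e μ} (θ n)) x * g x) atTop (𝓝 0) := by
    intro μ g hg
    refine htransfer (fun n => memLp_test _) (fun n => hgm n μ) (hs2 μ) hg ?_
    have h1 := ((hwd μ).tendsto_integral_test_sub (fun n => (hf n).memL2loc_weakDeriv μ)
      (hf₀.memL2loc_weakDeriv μ) ψ hg.memL2loc).add
      (hw.tendsto_integral_test_sub (fun n => (hf n).1) hf₀.1 (∂_{e μ} ψ) hg.memL2loc)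
    rw [zero_add] at h1
    refine h1.congr fun n => ?_
    have hi1 : Integrable fun x => ψ x * (weakDeriv μ (f n) x - weakDeriv μ f₀ x) * g x :=
      ((hsub' n μ).memLp_test_mul ψ).integrable_mul hg
    have hi2 : Integrable fun x => (∂_{e μ} ψ) x * (f n x - f₀ x) * g x :=
      ((hsub n).memLp_test_mul _).integrable_mul hg
    rw [← integral_add hi1 hi2]
    exact integral_congr_ae (ae_of_all _ fun x => by ring)
  obtain ⟨C, hC⟩ := exists_integral_sq_le_of_weak (fun n => memLp_test (θ n))
    fun g hg => ⟨0, hθw g hg⟩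
  choose D hD using fun μ => exists_integral_sq_le_of_weak (fun n => memLp_test (∂_{e μ} (θ n)))
    fun g hg => ⟨0, hθdw μ g hg⟩
  have hD0 : 0 ≤ ∑ μ, D μ := Finset.sum_nonneg fun μ _ =>
    (integral_nonneg fun x => sq_nonneg _).trans (hD μ 0)
  have hC0 : 0 ≤ C := (integral_nonneg fun x => sq_nonneg _).trans (hC 0)
  have hsum : ∀ n, ∑ μ, ∫ x, (∂_{e μ} (θ n)) x ^ 2 ≤ ∑ μ, D μ := fun n =>
    Finset.sum_le_sum fun μ _ => hD μ n
  refine ⟨R + 1, θ, fun x hx => hψR x (by linarith), hθ0, hs1, hs2, hθdw,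
    ⟨√(C + ∑ μ, D μ), fun n => Real.sqrt_le_sqrt (add_le_add (hC n) (hsum n))⟩, ?_⟩
  exact tendsto_integral_sq_of_weak hθ0 (fun n => (hC n).trans (le_add_of_nonneg_right hD0))
    (fun n => (hsum n).trans (le_add_of_nonneg_left hC0)) hθw

/-- Rellich's theorem: weak convergence in `H¹_loc` is strong convergence in `L²_loc`. -/
theorem WeakTendstoH1loc.tendsto_integral_sq {f : ℕ → Spacetime → ℝ} {f₀ : Spacetime → ℝ}
    (h : WeakTendstoH1loc f atTop f₀) (ψ : Test) :
    Tendsto (fun n => ∫ x, (ψ x * (f n x - f₀ x)) ^ 2) atTop (𝓝 0) := by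
  obtain ⟨-, θ, -, -, h1, -, -, -, h2⟩ := h.exists_test_approx ψ
  have hm : ∀ n, MemLp (fun x => ψ x * (f n x - f₀ x)) 2 := fun n =>
    ((h.1 n).1.sub h.2.1.1).memLp_test_mul ψ
  have h3 := (h1.const_mul 2).add (h2.const_mul 2)
  simp only [mul_zero, add_zero] at h3
  refine squeeze_zero (fun n => integral_nonneg fun x => sq_nonneg _) (fun n => ?_) h3
  have h4 := integral_add_sq_le ((hm n).sub (memLp_test (θ n))) (memLp_test (θ n))
  have h5 : ∀ x, (((fun x => ψ x * (f n x - f₀ x)) - fun x => θ n x) x + θ n x) ^ 2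
      = (ψ x * (f n x - f₀ x)) ^ 2 := fun x => by simp
  have h6 : ∀ x, (((fun x => ψ x * (f n x - f₀ x)) - fun x => θ n x) x) ^ 2
      = (θ n x - ψ x * (f n x - f₀ x)) ^ 2 := fun x => by simp only [Pi.sub_apply]; ring
  simp_rw [h5, h6] at h4
  exact h4

/-- A product of a strongly and a weakly convergent sequence of `L²_loc` converges in the sense of
distributions. -/
theorem tendsto_integral_test_mul_mul {u p : ℕ → Spacetime → ℝ} {u₀ p₀ : Spacetime → ℝ} (ψ : Test)
    (hu : ∀ n, MemL2loc (u n)) (hu₀ : MemL2loc u₀) (hp : ∀ n, MemL2loc (p n))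
    (hs : Tendsto (fun n => ∫ x, (ψ x * (u n x - u₀ x)) ^ 2) atTop (𝓝 0))
    (hw : WeakTendstoL2loc p atTop p₀) :
    Tendsto (fun n => ∫ x, ψ x * (u n x * p n x)) atTop (𝓝 (∫ x, ψ x * (u₀ x * p₀ x))) := by
  have hK : IsCompact (tsupport ψ) := ψ.hasCompactSupport
  obtain ⟨C, hC⟩ := hw.exists_integral_sq_le hp hK
  have hpm := fun n => (hp n).memLp_indicator hK
  have hum := fun n => ((hu n).sub hu₀).memLp_test_mul ψ
  have h1 := (tendsto_integral_mul_zero hpm hum hC hs).add (hw.tendsto_integral_test_mul ψ hu₀)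
  simp_rw [zero_add, mul_assoc] at h1
  refine h1.congr fun n => ?_
  have hi1 : Integrable fun x => (tsupport ψ).indicator (p n) x * (ψ x * (u n x - u₀ x)) :=
    (hpm n).integrable_mul (hum n)
  have hi2 : Integrable fun x => ψ x * (u₀ x * p n x) :=
    integrable_test_mul (hu₀.locallyIntegrable_mul (hp n)) ψ
  rw [← integral_add hi1 hi2]
  refine integral_congr_ae (ae_of_all _ fun x => ?_)
  by_cases hx : x ∈ tsupport ψ
  · simp only [Set.indicator_of_mem hx]
    ring
  · simp [image_eq_zero_of_notMem_tsupport hx]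

/-! ### The div-curl lemma -/

/-- The distribution `T` is the divergence `∑_ν ∂_ν W^ν` of the `L²_loc` vector field `W`. -/
def IsDivergence (T : Distrib4) (W : Fin 4 → Spacetime → ℝ) : Prop :=
  (∀ ν, MemL2loc (W ν)) ∧ ∀ χ : Test, T χ = -∑ ν, ∫ x, (∂_{e ν} χ) x * W ν x

/-- An element of a pre-compact subset of `H⁻¹_loc` that moves along a sequence pairs to `0` in
the limit with a sequence bounded in `H¹` and converging to `0` weakly in `H¹`. -/
theorem PrecompactHMinusOneLoc.tendsto_pairing_zero {S : Set Distrib4}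
    (hS : PrecompactHMinusOneLoc S) (hdiv : ∀ T ∈ S, ∃ W, IsDivergence T W) {T : ℕ → Distrib4}
    (hT : ∀ n, T n ∈ S) {θ : ℕ → Test} {R C : ℝ} (hR : ∀ n x, R < ‖x‖ → θ n x = 0)
    (hC : ∀ n, h1Norm (θ n) ≤ C)
    (hw : ∀ μ g, MemLp g 2 → Tendsto (fun n => ∫ x, (∂_{e μ} (θ n)) x * g x) atTop (𝓝 0)) :
    Tendsto (fun n => T n (θ n)) atTop (𝓝 0) := by
  have hsupp : ∀ n, tsupport (θ n) ⊆ Metric.closedBall 0 R := fun n =>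
    closure_minimal (fun x hx => by
      by_contra hx'
      exact hx (hR n x (by simpa using hx'))) Metric.isClosed_closedBall
  -- a fixed element of `S` pairs to `0` in the limit; a finite net reduces the others to this case
  have hfix : ∀ T' ∈ S, Tendsto (fun n => T' (θ n)) atTop (𝓝 0) := by
    intro T' hT'
    obtain ⟨W, hW, hTW⟩ := hdiv T' hT'
    simp_rw [hTW]
    rw [← neg_zero]
    refine Tendsto.neg ?_
    rw [← Finset.sum_const_zero (s := (Finset.univ : Finset (Fin 4)))]
    refine tendsto_finsetSum _ fun ν _ => ?_
    refine (hw ν _ ((hW ν).memLp_indicator (isCompact_closedBall 0 R))).congr fun n => ?_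
    refine integral_congr_ae (ae_of_all _ fun x => ?_)
    by_cases hx : x ∈ Metric.closedBall (0 : Spacetime) R
    · simp only [Set.indicator_of_mem hx]
    · have h1 : fderiv ℝ (θ n) x = 0 := by
        by_contra h
        exact hx (hsupp n (support_fderiv_subset ℝ h))
      simp [lineDeriv_test_apply, h1]
  have hC0 : 0 ≤ C := (Real.sqrt_nonneg _).trans (hC 0)
  refine Metric.tendsto_atTop.2 fun ε hε => ?_
  obtain ⟨t, htf, htS, ht⟩ := (hS (Metric.ball 0 (R + 1)) Metric.isOpen_ball
    Metric.isBounded_ball).2 (ε / (2 * (C + 1))) (by positivity)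
  have hev : ∀ᶠ n in atTop, ∀ T' ∈ t, |T' (θ n)| < ε / 2 := by
    refine (htf.eventually_all).2 fun T' hT' => ?_
    have h1 := (hfix T' (htS hT')).abs
    rw [abs_zero] at h1
    exact h1.eventually_lt_const (half_pos hε)
  obtain ⟨n₀, hn₀⟩ := eventually_atTop.1 hev
  refine ⟨n₀, fun n hn => ?_⟩
  obtain ⟨T', hT', hle⟩ := ht (T n) (hT n)
  have h1 := hle (θ n) ((hsupp n).trans (Metric.closedBall_subset_ball (by linarith)))
  have h2 : (T n - T') (θ n) = T n (θ n) - T' (θ n) := rfl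
  rw [h2] at h1
  have h3 : ε / (2 * (C + 1)) * h1Norm (θ n) ≤ ε / 2 := by
    calc ε / (2 * (C + 1)) * h1Norm (θ n) ≤ ε / (2 * (C + 1)) * (C + 1) := by
          gcongr
          exact (hC n).trans (by linarith)
      _ = ε / 2 := by field_simp
  rw [Real.dist_eq, sub_zero]
  have h4 := hn₀ n hn T' hT'
  have h5 : |T n (θ n)| ≤ |T n (θ n) - T' (θ n)| + |T' (θ n)| := by
    simpa using abs_add_le (T n (θ n) - T' (θ n)) (T' (θ n))
  linarith

theorem integral_sub_sub_add {α : Type*} [MeasurableSpace α] {m : Measure α} {a b c d : α → ℝ}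
    (ha : Integrable a m) (hb : Integrable b m) (hc : Integrable c m) (hd : Integrable d m) :
    (∫ x, a x ∂m) - (∫ x, b x ∂m) - (∫ x, c x ∂m) + ∫ x, d x ∂m
      = ∫ x, (a x - b x - c x + d x) ∂m := by
  have hab : Integrable (fun x => a x - b x) m := ha.sub hb
  have habc : Integrable (fun x => a x - b x - c x) m := hab.sub hc
  rw [integral_add habc hd, integral_sub hab hc, integral_sub ha hb]

/-- The div-curl lemma for a gradient: if `div V_n` is pre-compact in `H⁻¹_loc`, then
`V_n · ∂f_n` converges to `V · ∂f` in the sense of distributions. -/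
theorem tendsto_integral_divCurl {V : ℕ → Fin 4 → Spacetime → ℝ} {V₀ : Fin 4 → Spacetime → ℝ}
    {f : ℕ → Spacetime → ℝ} {f₀ : Spacetime → ℝ}
    (hVw : ∀ ν, WeakTendstoL2loc (fun n => V n ν) atTop (V₀ ν))
    (hf : WeakTendstoH1loc f atTop f₀) {S : Set Distrib4} (hS : PrecompactHMinusOneLoc S)
    (hdiv : ∀ T ∈ S, ∃ W, IsDivergence T W) {T : ℕ → Distrib4} (hT : ∀ n, T n ∈ S)
    (hTV : ∀ n, IsDivergence (T n) (V n)) (ψ : Test) :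
    Tendsto (fun n => ∑ ν, ∫ x, ψ x * (V n ν x * weakDeriv ν (f n) x)) atTop
      (𝓝 (∑ ν, ∫ x, ψ x * (V₀ ν x * weakDeriv ν f₀ x))) := by
  obtain ⟨R, θ, hψR, hθR, -, hθd, hθw, ⟨C, hC⟩, -⟩ := hf.exists_test_approx ψ
  have hK : IsCompact (Metric.closedBall (0 : Spacetime) R) := isCompact_closedBall 0 R
  have hV : ∀ n ν, MemL2loc (V n ν) := fun n => (hTV n).1
  have hfd := fun n ν => (hf.1 n).memL2loc_weakDeriv ν
  have hf0d := fun ν => hf.2.1.memL2loc_weakDeriv ν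
  have hVm := fun n ν => (hV n ν).memLp_indicator hK
  have hsub : ∀ n, MemL2loc (fun x => f n x - f₀ x) := fun n => (hf.1 n).1.sub hf.2.1.1
  have hsub' : ∀ n μ, MemL2loc (fun x => weakDeriv μ (f n) x - weakDeriv μ f₀ x) := fun n μ =>
    (hfd n μ).sub (hf0d μ)
  have hgm : ∀ n μ, MemLp (fun x => ψ x * (weakDeriv μ (f n) x - weakDeriv μ f₀ x) +
      (∂_{e μ} ψ) x * (f n x - f₀ x)) 2 := fun n μ =>
    ((hsub' n μ).memLp_test_mul ψ).add ((hsub n).memLp_test_mul _)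
  have hrm := fun n μ => (memLp_test (∂_{e μ} (θ n))).sub (hgm n μ)
  choose D hD using fun ν => (hVw ν).exists_integral_sq_le (fun n => hV n ν) hK
  -- with `g_n = ∂(ψ (f_n - f₀))` and `1_R` the indicator of the ball of radius `R`,
  -- `ψ V_n · ∂f_n = ψ ∂f₀ · V_n - 1_R V_n · (∂θ_n - g_n) - 1_R V_n · ∂ψ (f_n - f₀) + V_n · ∂θ_n`,
  -- where the last term integrates to `-(div V_n) θ_n`
  have hp0 := hS.tendsto_pairing_zero hdiv hT hθR hC hθw
  have hp1 : ∀ ν, Tendsto (fun n => ∫ x, ψ x * weakDeriv ν f₀ x * V n ν x) atTop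
      (𝓝 (∫ x, ψ x * weakDeriv ν f₀ x * V₀ ν x)) := fun ν =>
    (hVw ν).tendsto_integral_test_mul ψ (hf0d ν)
  have hp2 := fun ν => tendsto_integral_mul_zero (fun n => hVm n ν) (fun n => hrm n ν) (hD ν)
    (hθd ν)
  have hp3 := fun ν => tendsto_integral_mul_zero (fun n => hVm n ν)
    (fun n => (hsub n).memLp_test_mul (∂_{e ν} ψ)) (hD ν) (hf.tendsto_integral_sq (∂_{e ν} ψ))
  have hlim := (tendsto_finsetSum Finset.univ fun ν _ => ((hp1 ν).sub (hp2 ν)).sub (hp3 ν)).sub hp0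
  simp only [sub_zero] at hlim
  have heq : (∑ ν, ∫ x, ψ x * weakDeriv ν f₀ x * V₀ ν x)
      = ∑ ν, ∫ x, ψ x * (V₀ ν x * weakDeriv ν f₀ x) :=
    Finset.sum_congr rfl fun ν _ => integral_congr_ae (ae_of_all _ fun x => by ring)
  rw [heq] at hlim
  refine hlim.congr fun n => ?_
  rw [(hTV n).2, sub_neg_eq_add, ← Finset.sum_add_distrib]
  refine Finset.sum_congr rfl fun ν _ => ?_
  have hi1 : Integrable fun x => ψ x * weakDeriv ν f₀ x * V n ν x := by
    simpa only [mul_assoc] using integrable_test_mul ((hf0d ν).locallyIntegrable_mul (hV n ν)) ψ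
  have hi2 : Integrable fun x => (Metric.closedBall 0 R).indicator (V n ν) x * _ :=
    (hVm n ν).integrable_mul (hrm n ν)
  have hi3 : Integrable fun x => (Metric.closedBall 0 R).indicator (V n ν) x * _ :=
    (hVm n ν).integrable_mul ((hsub n).memLp_test_mul (∂_{e ν} ψ))
  have hi4 := (hV n ν).integrable_test_mul (∂_{e ν} (θ n))
  refine (integral_sub_sub_add hi1 hi2 hi3 hi4).trans ?_
  refine integral_congr_ae (ae_of_all _ fun x => ?_)
  simp only [Pi.sub_apply]
  by_cases hx : x ∈ Metric.closedBall (0 : Spacetime) R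
  · rw [Set.indicator_of_mem hx]
    ring
  · have hx' : ∀ y ∈ (Metric.closedBall (0 : Spacetime) R)ᶜ, R < ‖y‖ := fun y hy => by
      simpa using hy
    have h1 : (∂_{e ν} (θ n)) x = 0 := by
      have h2 : (θ n : Spacetime → ℝ) =ᶠ[𝓝 x] fun _ => 0 := by
        filter_upwards [Metric.isClosed_closedBall.isOpen_compl.mem_nhds hx] with y hy
        exact hθR n y (hx' y hy)
      rw [lineDeriv_test_apply, h2.fderiv_eq]
      simp
    rw [Set.indicator_of_notMem hx, hψR x (hx' x hx), h1]
    ring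

/-! ### Convergence in the sense of distributions -/

namespace TendstoInDistributions

variable {ι : Type*} {l : Filter ι} {f g : ι → Spacetime → ℝ} {f₀ g₀ : Spacetime → ℝ}

theorem add (hf : TendstoInDistributions f l f₀) (hg : TendstoInDistributions g l g₀) :
    TendstoInDistributions (fun i x => f i x + g i x) l (fun x => f₀ x + g₀ x) := by
  have key : ∀ {u v : Spacetime → ℝ} (_ : LocallyIntegrable u) (_ : LocallyIntegrable v)
      (ψ : Test), toDistrib (fun x => u x + v x) ψ = toDistrib u ψ + toDistrib v ψ := by
    intro u v hu hv ψ
    have huv : LocallyIntegrable (fun x => u x + v x) := hu.add hv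
    rw [toDistrib_apply hu, toDistrib_apply hv, toDistrib_apply huv,
      ← integral_add (integrable_test_mul hu ψ) (integrable_test_mul hv ψ)]
    simp [mul_add]
  refine ⟨fun i => (hf.1 i).add (hg.1 i), hf.2.1.add hg.2.1, fun ψ => ?_⟩
  simp_rw [key (hf.1 _) (hg.1 _), key hf.2.1 hg.2.1]
  exact (hf.2.2 ψ).add (hg.2.2 ψ)

theorem const_mul (hf : TendstoInDistributions f l f₀) (c : ℝ) :
    TendstoInDistributions (fun i x => c * f i x) l (fun x => c * f₀ x) := by
  have key : ∀ {u : Spacetime → ℝ} (_ : LocallyIntegrable u) (ψ : Test),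
      toDistrib (fun x => c * u x) ψ = c * toDistrib u ψ := by
    intro u hu ψ
    have hcu : LocallyIntegrable (fun x => c * u x) := hu.smul c
    rw [toDistrib_apply hu, toDistrib_apply hcu, ← integral_const_mul]
    exact integral_congr_ae (ae_of_all _ fun x => by ring)
  refine ⟨fun i => (hf.1 i).smul c, hf.2.1.smul c, fun ψ => ?_⟩
  simp_rw [key (hf.1 _), key hf.2.1]
  exact (hf.2.2 ψ).const_mul c

theorem zero : TendstoInDistributions (fun (_ : ι) (_ : Spacetime) => (0 : ℝ)) l fun _ => 0 :=
  ⟨fun _ => locallyIntegrable_zero, locallyIntegrable_zero, fun _ => tendsto_const_nhds⟩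

theorem sum {κ : Type*} (s : Finset κ) {f : κ → ι → Spacetime → ℝ} {f₀ : κ → Spacetime → ℝ}
    (h : ∀ k ∈ s, TendstoInDistributions (f k) l (f₀ k)) :
    TendstoInDistributions (fun i x => ∑ k ∈ s, f k i x) l (fun x => ∑ k ∈ s, f₀ k x) := by
  classical
  induction s using Finset.induction_on with
  | empty => simpa using zero
  | insert a s ha ih =>
    simp_rw [Finset.sum_insert ha]
    exact (h a (by simp)).add (ih fun k hk => h k (by simp [hk]))

/-- Along a countably generated filter, convergence may be tested on sequences. -/
theorem of_seq [l.IsCountablyGenerated] (hf : ∀ i, LocallyIntegrable (f i))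
    (hf₀ : LocallyIntegrable f₀)
    (h : ∀ x : ℕ → ι, Tendsto x atTop l → TendstoInDistributions (fun n => f (x n)) atTop f₀) :
    TendstoInDistributions f l f₀ :=
  ⟨hf, hf₀, fun ψ => tendsto_of_seq_tendsto fun x hx => (h x hx).2.2 ψ⟩

end TendstoInDistributions

theorem WeakTendstoL2loc.comp {ι κ : Type*} {l : Filter ι} {l' : Filter κ}
    {u : ι → Spacetime → ℝ} {u₀ : Spacetime → ℝ} (h : WeakTendstoL2loc u l u₀) {x : κ → ι}
    (hx : Tendsto x l' l) : WeakTendstoL2loc (fun n => u (x n)) l' u₀ :=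
  fun g hg hs => (h g hg hs).comp hx

theorem WeakTendstoH1loc.comp {ι κ : Type*} {l : Filter ι} {l' : Filter κ}
    {u : ι → Spacetime → ℝ} {u₀ : Spacetime → ℝ} (h : WeakTendstoH1loc u l u₀) {x : κ → ι}
    (hx : Tendsto x l' l) : WeakTendstoH1loc (fun n => u (x n)) l' u₀ :=
  ⟨fun n => h.1 (x n), h.2.1, h.2.2.1.comp hx, fun μ => (h.2.2.2 μ).comp hx⟩

theorem WeakTendstoL2loc.tendstoInDistributions {ι : Type*} {l : Filter ι}
    {u : ι → Spacetime → ℝ} {u₀ : Spacetime → ℝ} (h : WeakTendstoL2loc u l u₀)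
    (hu : ∀ i, MemL2loc (u i)) (hu₀ : MemL2loc u₀) : TendstoInDistributions u l u₀ := by
  refine ⟨fun i => (hu i).locallyIntegrable, hu₀.locallyIntegrable, fun ψ => ?_⟩
  simp_rw [toDistrib_apply (hu _).locallyIntegrable, toDistrib_apply hu₀.locallyIntegrable]
  simpa only [mul_comm] using h ψ (memLp_test ψ) ψ.hasCompactSupport

theorem WeakTendstoL2loc.sum_const_mul {ι κ : Type*} {l : Filter ι} (s : Finset κ) (c : κ → ℝ)
    {u : κ → ι → Spacetime → ℝ} {u₀ : κ → Spacetime → ℝ}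
    (h : ∀ k, WeakTendstoL2loc (u k) l (u₀ k)) (hu : ∀ k i, MemL2loc (u k i))
    (hu₀ : ∀ k, MemL2loc (u₀ k)) :
    WeakTendstoL2loc (fun i x => ∑ k ∈ s, c k * u k i x) l (fun x => ∑ k ∈ s, c k * u₀ k x) := by
  intro g hg hs
  have hint : ∀ {v : Spacetime → ℝ}, MemL2loc v → Integrable fun x => v x * g x := by
    intro v hv
    have h1 : Integrable fun x => (tsupport g).indicator v x * g x :=
      (hv.memLp_indicator hs).integrable_mul hg
    refine h1.congr (ae_of_all _ fun x => ?_)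
    by_cases hx : x ∈ tsupport g
    · simp only [Set.indicator_of_mem hx]
    · simp [image_eq_zero_of_notMem_tsupport hx]
  have key : ∀ {v : κ → Spacetime → ℝ}, (∀ k, MemL2loc (v k)) →
      ∫ x, (∑ k ∈ s, c k * v k x) * g x = ∑ k ∈ s, c k * ∫ x, v k x * g x := by
    intro v hv
    simp_rw [Finset.sum_mul, mul_assoc]
    rw [integral_finsetSum _ fun k _ => (hint (hv k)).const_mul _]
    simp_rw [integral_const_mul]
  simp_rw [key (hu₀), key fun k => hu k _]
  exact tendsto_finsetSum _ fun k _ => (h k g hg hs).const_mul _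

/-! ### Quadratic sources -/

/-- The second derivative of a quadratic form recovers the form. -/
theorem iteratedFDeriv_two_quadraticForm {E : Type*} [NormedAddCommGroup E] [NormedSpace ℝ E]
    [FiniteDimensional ℝ E] (q : QuadraticForm ℝ E) (z : E) :
    iteratedFDeriv ℝ 2 (fun x => q x) 0 (fun _ => z) = 2 * q z := by
  -- `q x = B x x` has the derivative `B + B.flip` at `x`, a linear function of `x`
  let B : E →L[ℝ] E →L[ℝ] ℝ := LinearMap.toContinuousLinearMap
    ((LinearMap.toContinuousLinearMap : (E →ₗ[ℝ] ℝ) ≃ₗ[ℝ] (E →L[ℝ] ℝ)).toLinearMap ∘ₗ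
      QuadraticMap.associated q)
  have hB : ∀ x, q x = B x x := fun x => (QuadraticMap.associated_eq_self_apply ℝ q x).symm
  have h1 : fderiv ℝ (fun x => q x) = fun x => (B + B.flip) x := by
    funext x
    have h2 : HasFDerivAt (fun x => B x x) _ x :=
      B.hasFDerivAt_of_bilinear (hasFDerivAt_id x) (hasFDerivAt_id x)
    simp_rw [hB]
    rw [h2.fderiv]
    ext y
    simp [ContinuousLinearMap.precompR_apply, ContinuousLinearMap.precompL_apply]
  rw [iteratedFDeriv_two_apply, h1, ContinuousLinearMap.fderiv, hB]
  simp [two_mul]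

theorem quadraticPart_quadraticForm {N : ℕ} (q : QuadraticForm ℝ (Jet N)) (p : Grad N) :
    quadraticPart (fun z => q z) p = q (0, p) := by
  rw [quadraticPart, iteratedFDeriv_two_quadraticForm]
  ring

/-- A quadratic form in `(φ, ∂φ)` is its part quadratic in `∂φ` plus terms that contain an
undifferentiated `φ`. -/
theorem exists_quadraticForm_jet_eq {N : ℕ} (q : QuadraticForm ℝ (Jet N)) :
    ∃ (a : Fin N → Fin N → ℝ) (b : Fin N → Fin 4 → Fin N → ℝ), ∀ (u : Fin N → ℝ) (p : Grad N),
      q (u, p) = q (0, p) + (∑ J, ∑ K, a J K * (u J * u K))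
        + ∑ J, ∑ μ, ∑ K, b J μ K * (u J * p μ K) := by
  let S : Jet N →ₗ[ℝ] Jet N →ₗ[ℝ] ℝ := QuadraticMap.associated q
  have hS : ∀ z, q z = S z z := fun z => (QuadraticMap.associated_eq_self_apply ℝ q z).symm
  have hsymm : ∀ z w, S z w = S w z := QuadraticMap.associated_isSymm ℝ q
  let i : Fin N → Jet N := fun J => (Pi.single J 1, 0)
  let j : Fin 4 → Fin N → Jet N := fun μ K => (0, Pi.single μ (Pi.single K 1))
  refine ⟨fun J K => S (i J) (i K), fun J μ K => 2 * S (i J) (j μ K), fun u p => ?_⟩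
  have hu : ((u, 0) : Jet N) = ∑ J, u J • i J := by
    refine Prod.ext ?_ ?_
    · ext K
      simp [i, Prod.fst_sum, Finset.sum_apply, Pi.single_apply]
    · simp [i, Prod.snd_sum]
  have hp : ((0, p) : Jet N) = ∑ μ, ∑ K, p μ K • j μ K := by
    refine Prod.ext ?_ ?_
    · simp [j, Prod.fst_sum]
    · ext ν L
      have : ∀ μ K, (Pi.single μ (Pi.single K (1 : ℝ)) : Grad N) ν L
          = if ν = μ then (if L = K then 1 else 0) else 0 := by
        intro μ K
        rw [Pi.single_apply]
        split_ifs <;> simp_all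
      simp [j, Prod.snd_sum, Finset.sum_apply, this]
  have h1 : ((u, p) : Jet N) = (u, 0) + (0, p) := by simp
  have h2 : S (u, 0) (u, 0) = ∑ J, ∑ K, S (i J) (i K) * (u J * u K) := by
    rw [hu]
    simp only [map_sum, map_smul, LinearMap.sum_apply, LinearMap.smul_apply, smul_eq_mul,
      Finset.mul_sum]
    rw [Finset.sum_comm]
    exact Finset.sum_congr rfl fun J _ => Finset.sum_congr rfl fun K _ => by ring
  have h3 : S (u, 0) (0, p) = ∑ J, ∑ μ, ∑ K, S (i J) (j μ K) * (u J * p μ K) := by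
    rw [hu, hp]
    simp only [map_sum, map_smul, LinearMap.sum_apply, LinearMap.smul_apply, smul_eq_mul,
      Finset.mul_sum]
    rw [Finset.sum_comm_cycle]
    exact Finset.sum_congr rfl fun J _ => Finset.sum_congr rfl fun μ _ =>
      Finset.sum_congr rfl fun K _ => by ring
  have h4 : q (u, p) = q (0, p) + S (u, 0) (u, 0) + 2 * S (u, 0) (0, p) := by
    rw [hS, h1, hS (0, p)]
    simp only [map_add, LinearMap.add_apply]
    rw [hsymm (0, p) (u, 0)]
    ring
  rw [h4, h2, h3]
  simp_rw [Finset.mul_sum, mul_assoc]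

/-! ### Passage to the limit in the system -/

theorem distrib_sum_apply {κ : Type*} (s : Finset κ) (T : κ → Distrib4) (χ : Test) :
    (∑ k ∈ s, T k) χ = ∑ k ∈ s, T k χ :=
  map_sum (AddMonoidHom.mk' (fun T : Distrib4 => T χ) fun _ _ => rfl) T s

/-- The vector field `V_K^ν = ∑ A^{μν}_{JK} ∂_μ φ^J`, whose divergence is `(𝒯 ∂φ)_K`. -/
def flux {N : ℕ} (A : Fin N → Fin N → Fin 4 → Fin 4 → ℝ) (φ : Fin N → Spacetime → ℝ) (K : Fin N)
    (ν : Fin 4) (x : Spacetime) : ℝ :=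
  ∑ k : Fin N × Fin 4, A k.1 K k.2 ν * weakDeriv k.2 (φ k.1) x

section Flux

variable {N : ℕ} (A : Fin N → Fin N → Fin 4 → Fin 4 → ℝ) {φ : Fin N → Spacetime → ℝ}

theorem memL2loc_flux (hφ : ∀ J, MemH1loc (φ J)) (K : Fin N) (ν : Fin 4) :
    MemL2loc (flux A φ K ν) :=
  MemL2loc.sum _ fun k _ => ((hφ k.1).memL2loc_weakDeriv k.2).const_mul _

theorem isDivergence_flux (hφ : ∀ J, MemH1loc (φ J)) (K : Fin N) :
    IsDivergence (opT A (distribGradient φ) K) (flux A φ K) := by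
  refine ⟨memL2loc_flux A hφ K, fun χ => ?_⟩
  have h1 : opT A (distribGradient φ) K χ
      = ∑ J, ∑ μ, ∑ ν, A J K μ ν * (∂_{e ν} (distribGradient φ μ J)) χ := by
    simp only [opT, distrib_sum_apply]
    rfl
  have h2 : ∀ J μ ν, (∂_{e ν} (distribGradient φ μ J)) χ
      = -∫ x, (∂_{e ν} χ) x * weakDeriv μ (φ J) x := by
    intro J μ ν
    rw [distribGradient, (isWeakDeriv_weakDeriv (hφ J) μ).2, Distribution.lineDerivOp_apply_apply,
      map_neg, toDistrib_apply ((hφ J).memL2loc_weakDeriv μ).locallyIntegrable]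
  have h3 : ∀ ν, ∫ x, (∂_{e ν} χ) x * flux A φ K ν x
      = ∑ k : Fin N × Fin 4, A k.1 K k.2 ν * ∫ x, (∂_{e ν} χ) x * weakDeriv k.2 (φ k.1) x := by
    intro ν
    have : ∀ x, (∂_{e ν} χ) x * flux A φ K ν x
        = ∑ k : Fin N × Fin 4, A k.1 K k.2 ν * ((∂_{e ν} χ) x * weakDeriv k.2 (φ k.1) x) := by
      intro x
      rw [flux, Finset.mul_sum]
      exact Finset.sum_congr rfl fun k _ => by ring
    simp_rw [this]
    rw [integral_finsetSum _ fun k _ =>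
      (((hφ k.1).memL2loc_weakDeriv k.2).integrable_test_mul _).const_mul _]
    simp_rw [integral_const_mul]
  simp_rw [h1, h2, h3]
  rw [Finset.sum_comm (s := (Finset.univ : Finset (Fin 4))), Fintype.sum_prod_type,
    ← Finset.sum_neg_distrib]
  refine Finset.sum_congr rfl fun J _ => ?_
  rw [← Finset.sum_neg_distrib]
  refine Finset.sum_congr rfl fun μ _ => ?_
  rw [← Finset.sum_neg_distrib]
  exact Finset.sum_congr rfl fun ν _ => by ring

/-- The null form `A^{μν}_{JK} ∂_μ φ^J ∂_ν φ^K` is the sum over `K` of the products of the flux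
`V_K` with the gradient of `φ^K`. -/
theorem sum_flux_mul (φ : Fin N → Spacetime → ℝ) (x : Spacetime) :
    ∑ J, ∑ K, ∑ μ, ∑ ν, A J K μ ν * gradient φ x μ J * gradient φ x ν K
      = ∑ K, ∑ ν, flux A φ K ν x * weakDeriv ν (φ K) x := by
  rw [Finset.sum_comm]
  refine Finset.sum_congr rfl fun K _ => ?_
  simp only [flux, gradient, Fintype.sum_prod_type, Finset.sum_mul]
  rw [Finset.sum_comm_cycle]

theorem tendsto_flux {ι : Type*} {l : Filter ι} {φε : ι → Fin N → Spacetime → ℝ}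
    (hweak : ∀ J, WeakTendstoH1loc (fun i => φε i J) l (φ J)) (K : Fin N) (ν : Fin 4) :
    WeakTendstoL2loc (fun i => flux A (φε i) K ν) l (flux A φ K ν) :=
  WeakTendstoL2loc.sum_const_mul (Finset.univ : Finset (Fin N × Fin 4)) _
    (fun k => (hweak k.1).2.2.2 k.2) (fun k i => ((hweak k.1).1 i).memL2loc_weakDeriv k.2)
    fun k => (hweak k.1).2.1.memL2loc_weakDeriv k.2

end Flux

theorem tendstoInDistributions_mul {u p : ℕ → Spacetime → ℝ} {u₀ p₀ : Spacetime → ℝ}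
    (hu : WeakTendstoH1loc u atTop u₀) (hp : ∀ n, MemL2loc (p n)) (hp₀ : MemL2loc p₀)
    (hw : WeakTendstoL2loc p atTop p₀) :
    TendstoInDistributions (fun n x => u n x * p n x) atTop (fun x => u₀ x * p₀ x) := by
  have h1 := fun n => (hu.1 n).1.locallyIntegrable_mul (hp n)
  have h2 := hu.2.1.1.locallyIntegrable_mul hp₀
  refine ⟨h1, h2, fun ψ => ?_⟩
  simp_rw [toDistrib_apply (h1 _), toDistrib_apply h2]
  exact tendsto_integral_test_mul_mul ψ (fun n => (hu.1 n).1) hu.2.1.1 hp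
    (hu.tendsto_integral_sq ψ) hw

/-- Weak continuity of the quadratic form `A^{μν}_{JK} ∂_μ φ^J ∂_ν φ^K` along a sequence. -/
theorem tendstoInDistributions_flux {N : ℕ} (A : Fin N → Fin N → Fin 4 → Fin 4 → ℝ)
    {φn : ℕ → Fin N → Spacetime → ℝ} {φ : Fin N → Spacetime → ℝ}
    (hweak : ∀ J, WeakTendstoH1loc (fun n => φn n J) atTop (φ J)) {S : Fin N → Set Distrib4}
    (hS : ∀ K, PrecompactHMinusOneLoc (S K)) (hdiv : ∀ K, ∀ T ∈ S K, ∃ W, IsDivergence T W)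
    (hmem : ∀ n K, opT A (distribGradient (φn n)) K ∈ S K) :
    TendstoInDistributions (fun n x => ∑ K, ∑ ν, flux A (φn n) K ν x * weakDeriv ν (φn n K) x)
      atTop (fun x => ∑ K, ∑ ν, flux A φ K ν x * weakDeriv ν (φ K) x) := by
  refine TendstoInDistributions.sum _ fun K _ => ?_
  have hH := fun n J => (hweak J).1 n
  have hH0 := fun J => (hweak J).2.1
  have hli : ∀ {χ : Fin N → Spacetime → ℝ}, (∀ J, MemH1loc (χ J)) → ∀ ν,
      LocallyIntegrable (fun x => flux A χ K ν x * weakDeriv ν (χ K) x) := fun hχ ν =>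
    (memL2loc_flux A hχ K ν).locallyIntegrable_mul ((hχ K).memL2loc_weakDeriv ν)
  have hls : ∀ {χ : Fin N → Spacetime → ℝ}, (∀ J, MemH1loc (χ J)) →
      LocallyIntegrable (fun x => ∑ ν, flux A χ K ν x * weakDeriv ν (χ K) x) := fun hχ =>
    locallyIntegrable_finsetSum _ fun ν _ => hli hχ ν
  have key : ∀ {χ : Fin N → Spacetime → ℝ}, (∀ J, MemH1loc (χ J)) → ∀ ψ : Test,
      toDistrib (fun x => ∑ ν, flux A χ K ν x * weakDeriv ν (χ K) x) ψ
        = ∑ ν, ∫ x, ψ x * (flux A χ K ν x * weakDeriv ν (χ K) x) := by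
    intro χ hχ ψ
    rw [toDistrib_apply (hls hχ), ← integral_finsetSum _ fun ν _ => integrable_test_mul (hli hχ ν) ψ]
    simp_rw [Finset.mul_sum]
  refine ⟨fun n => hls (hH n), hls hH0, fun ψ => ?_⟩
  simp_rw [key (hH _), key hH0]
  exact tendsto_integral_divCurl (fun ν => tendsto_flux A hweak K ν) (hweak K) (hS K) (hdiv K)
    (fun n => hmem n K) (fun n => isDivergence_flux A (hH n) K) ψ

/-- The d'Alembertian is continuous for the convergence of distributions. -/
theorem tendsto_box {ι : Type*} {l : Filter ι} {T : ι → Distrib4} {T₀ : Distrib4}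
    (h : ∀ ψ : Test, Tendsto (fun i => T i ψ) l (𝓝 (T₀ ψ))) (ψ : Test) :
    Tendsto (fun i => box (T i) ψ) l (𝓝 (box T₀ ψ)) := by
  have key : ∀ T : Distrib4, box T ψ
      = ∑ μ, ∑ ν, minkowski μ ν * T (-∂_{e ν} (-∂_{e μ} ψ)) := by
    intro T
    simp only [box, distrib_sum_apply]
    refine Finset.sum_congr rfl fun μ _ => Finset.sum_congr rfl fun ν _ => ?_
    change minkowski μ ν * (∂_{e μ} (∂_{e ν} T)) ψ = _
    rw [Distribution.lineDerivOp_apply_apply, Distribution.lineDerivOp_apply_apply]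
  simp_rw [key]
  exact tendsto_finsetSum _ fun μ _ => tendsto_finsetSum _ fun ν _ => (h _).const_mul _

end NullWave

end

open MeasureTheory Filter Topology NullWave
theorem proposition6p2 {N : ℕ}
    (F : Fin N → Jet N → ℝ)
    (A : Fin N → Fin N → Fin N → Fin 4 → Fin 4 → ℝ)
    -- the source consists of quadratic terms in `(φ, ∂φ)`
    (hF : ∀ I, ∃ q : QuadraticForm ℝ (Jet N), ∀ z, F I z = q z)
    (hnull : NullCondition F A)
    (hcone : ∀ I, ∀ s ∈ operatorCone (A I), quadraticPart (F I) s = 0)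
    -- the family `φ_ε`, indexed by `ι`, and its limit along `l` (for instance `ε → 0⁺`)
    {ι : Type*} (l : Filter ι) [l.NeBot] [l.IsCountablyGenerated]
    (φε : ι → Fin N → Spacetime → ℝ) (φ : Fin N → Spacetime → ℝ)
    (hweak : ∀ J, WeakTendstoH1loc (fun i => φε i J) l (φ J))
    -- `∑ A^{μν}_{IJK} ∂_μ ∂_ν φ_ε^J` is pre-compact in `H⁻¹_loc`
    (hcompact : ∀ I K, PrecompactHMinusOneLoc
      (Set.range fun i => opT (A I) (distribGradient (φε i)) K)) :
    (∀ I, TendstoInDistributions (fun i x => quadraticPart (F I) (gradient (φε i) x)) l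
      (fun x => quadraticPart (F I) (gradient φ x))) ∧
    ((∀ i, IsWeakSolution F (φε i)) → IsWeakSolution F φ) := by
  have hH := fun i J => (hweak J).1 i
  have hH0 := fun J => (hweak J).2.1
  have hquad : ∀ I (χ : Fin N → Spacetime → ℝ) x, quadraticPart (F I) (gradient χ x)
      = ∑ K, ∑ ν, flux (A I) χ K ν x * weakDeriv ν (χ K) x := fun I χ x => by
    rw [hnull.quadratic, sum_flux_mul]
  have hflux_li : ∀ I (χ : Fin N → Spacetime → ℝ), (∀ J, MemH1loc (χ J)) →
      LocallyIntegrable (fun x => ∑ K, ∑ ν, flux (A I) χ K ν x * weakDeriv ν (χ K) x) :=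
    fun I χ hχ => locallyIntegrable_finsetSum _ fun K _ => locallyIntegrable_finsetSum _ fun ν _ =>
      (memL2loc_flux (A I) hχ K ν).locallyIntegrable_mul ((hχ K).memL2loc_weakDeriv ν)
  have hmain : ∀ I, TendstoInDistributions
      (fun i x => quadraticPart (F I) (gradient (φε i) x)) l
      (fun x => quadraticPart (F I) (gradient φ x)) := by
    intro I
    simp_rw [hquad]
    refine TendstoInDistributions.of_seq (fun i => hflux_li I _ (hH i)) (hflux_li I _ hH0)
      fun s hs => ?_
    refine tendstoInDistributions_flux (A I) (fun J => (hweak J).comp hs) (hcompact I) ?_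
      fun n K => ⟨s n, rfl⟩
    rintro K _ ⟨i, rfl⟩
    exact ⟨_, isDivergence_flux (A I) (hH i) K⟩
  -- the remaining terms of the source contain an undifferentiated factor `φ_ε`, which converges
  -- strongly in `L²_loc`, so the whole source passes to the limit
  refine ⟨hmain, fun hsol => ⟨hH0, fun I => ?_⟩⟩
  obtain ⟨q, hq⟩ := hF I
  obtain ⟨a, b, hab⟩ := exists_quadraticForm_jet_eq q
  have hsplit : ∀ (χ : Fin N → Spacetime → ℝ) x, F I (jet χ x)
      = quadraticPart (F I) (gradient χ x) + (∑ J, ∑ K, a J K * (χ J x * χ K x))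
        + ∑ J, ∑ μ, ∑ K, b J μ K * (χ J x * weakDeriv μ (χ K) x) := by
    intro χ x
    have hFq : F I = fun z => q z := funext hq
    rw [hFq, quadraticPart_quadraticForm, jet]
    exact hab _ _
  have hprod : ∀ {p : ι → Spacetime → ℝ} {p₀ : Spacetime → ℝ} (J : Fin N)
      (_ : ∀ i, MemL2loc (p i)) (_ : MemL2loc p₀) (_ : WeakTendstoL2loc p l p₀),
      TendstoInDistributions (fun i x => φε i J x * p i x) l (fun x => φ J x * p₀ x) := by
    intro p p₀ J hp hp₀ hw
    exact TendstoInDistributions.of_seq (fun i => (hH i J).1.locallyIntegrable_mul (hp i))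
      ((hH0 J).1.locallyIntegrable_mul hp₀) fun s hs =>
        tendstoInDistributions_mul ((hweak J).comp hs) (fun n => hp (s n)) hp₀ (hw.comp hs)
  have hFlim : TendstoInDistributions (fun i x => F I (jet (φε i) x)) l
      (fun x => F I (jet φ x)) := by
    simp_rw [hsplit]
    refine ((hmain I).add (.sum _ fun J _ => .sum _ fun K _ => .const_mul ?_ _)).add
      (.sum _ fun J _ => .sum _ fun μ _ => .sum _ fun K _ => .const_mul ?_ _)
    · exact hprod J (fun i => (hH i K).1) (hH0 K).1 (hweak K).2.2.1
    · exact hprod J (fun i => (hH i K).memL2loc_weakDeriv μ) ((hH0 K).memL2loc_weakDeriv μ)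
        ((hweak K).2.2.2 μ)
  refine ⟨hFlim.2.1, ?_⟩
  ext ψ
  have hbox := tendsto_box ((hweak I).2.2.1.tendstoInDistributions (fun i => (hH i I).1)
    (hH0 I).1).2.2 ψ
  refine tendsto_nhds_unique hbox ((hFlim.2.2 ψ).congr fun i => ?_)
  rw [((hsol i).2 I).2]
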